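/- **Theorem (Parity Proof Framework).** A *triangulation of $B^i$* is a finite geometric simplicial complex $K$ in some $\mathbb{R}^d$ whose underlying space $|K|$ is homeomorphic to the closed unit ball $B^i\subset\mathbb{R}^i$; its boundary $\partial K$ consists of the simplices of $K$ contained in the boundary of the ball $|K|$ (the image of the unit sphere under the homeomorphism). $K$ is *antipodally symmetric on the boundary* if $-\sigma\in\partial K$ for every $\sigma\in\partial K$. Let $T$ be a triangulation of $B^n$ that is antipodally symmetric on the boundary and aligned with hemispheres: there is a sequence $T^n=T,T^{n-1},\dots,T^0$, where $T^i$ is a triangulation of $B^i$ (in the same $\mathbb{R}^d$) that is antipodally symmetric on the boundary, such that for $i=1,\dots,n$, as sets of simplices, $T^{i-1}\cup(-T^{i-1})=\partial T^i$ and $T^{i-1}\cap(-T^{i-1})=\partial T^{i-1}$. Fix such a sequence. Let $L$ be a label set with an involution $a\mapsto -a$ without fixed points. Let $L^i$ be the set of $i$-labellings, i.e. multisets of $i+1$ labels; the opposite $-\ell$ of a labelling $\ell$ is obtained by replacing each label by its opposite. A set of labellings is *strictly symmetric* if it is closed under $\ell\mapsto-\ell$ and contains no $\ell$ with $-\ell=\ell$.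 Let $F\subseteq\bigcup_{i=0}^n L^i$ be a set of forbidden labellings such that $L^i\setminus F$ is strictly symmetric for all $i=0,\dots,n$, and such that every labelling in $\bigcup_{i=0}^n L^i$ that contains a forbidden labelling is itself forbidden. Let $\lambda$ assign a label to each vertex of $T$, with $\lambda(v)=-\lambda(-v)$ for every vertex $v$ on the boundary, and suppose that no simplex of $T$ has its labelling (the multiset of labels of its vertices) in $F$. Put $M^0:=L^0$. For $i=1,\dots,n$, once $M^{i-1}$ is defined, choose (arbitrarily) a set $M^{i-1}_+\subseteq M^{i-1}$ containing exactly one labelling of each pair of opposite labellings in $M^{i-1}$, and let $M^i$ be the set of $\ell\in L^i\setminus F$ that contain, counted with multiplicity, an odd number of $(i-1)$-labellings from $M^{i-1}_+$ (that is, among the $i+1$ sub-multisets obtained by removing one occurrence of a label from $\ell$, an odd number lie in $M^{i-1}_+$). Then, for every $i=0,\dots,n$ and whatever the choices of $M^0_+,\dots,M^{i-1}_+$: 1. $M^i$ is strictly symmetric, so that a choice of $M^i_+$ as above exists; and 2. $T^i$ contains an odd number of $i$-simplices whose labelling lies in $M^i$. -/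

import Mathlib

/-! ### Triangulations of balls -/

/-- The antipodal simplices `-σ` of a family of simplices, each given by its vertex set. -/
def antipodalFaces {d : ℕ} (A : Set (Finset (EuclideanSpace ℝ (Fin d)))) :
    Set (Finset (EuclideanSpace ℝ (Fin d))) :=
  (fun s => s.map (Equiv.neg (EuclideanSpace ℝ (Fin d))).toEmbedding) '' A

/-- `K` is a finite simplicial complex whose underlying space is homeomorphic to the closed unit
ball of `ℝⁱ`. -/
def IsBallTriangulation {d : ℕ} (i : ℕ)
    (K : Geometry.SimplicialComplex ℝ (EuclideanSpace ℝ (Fin d))) : Prop :=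
  K.faces.Finite ∧
    Nonempty (Metric.closedBall (0 : EuclideanSpace ℝ (Fin i)) 1 ≃ₜ K.space)

/-- The boundary of a set `X` homeomorphic to the closed unit ball of `ℝⁱ`: the points that
correspond to points of the unit sphere. (By invariance of domain this does not depend on the
homeomorphism, and for `X ⊆ ℝⁱ` it is the topological frontier of `X`.) -/
def ballBoundary {d : ℕ} (i : ℕ) (X : Set (EuclideanSpace ℝ (Fin d))) :
    Set (EuclideanSpace ℝ (Fin d)) :=
  {x | ∃ (h : Metric.closedBall (0 : EuclideanSpace ℝ (Fin i)) 1 ≃ₜ X)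
    (y : Metric.closedBall (0 : EuclideanSpace ℝ (Fin i)) 1),
      ‖(y : EuclideanSpace ℝ (Fin i))‖ = 1 ∧ (h y : EuclideanSpace ℝ (Fin d)) = x}

/-- The simplices of `∂K`: those simplices of `K` that lie entirely in the boundary. -/
def boundaryFaces {d : ℕ} (i : ℕ)
    (K : Geometry.SimplicialComplex ℝ (EuclideanSpace ℝ (Fin d))) :
    Set (Finset (EuclideanSpace ℝ (Fin d))) :=
  {s | s ∈ K.faces ∧
    convexHull ℝ (s : Set (EuclideanSpace ℝ (Fin d))) ⊆ ballBoundary i K.space}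

/-- With every simplex `σ` of `∂K`, the reflected simplex `-σ` also lies in `∂K`. -/
def AntipodallySymmetricOnBoundary {d : ℕ} (i : ℕ)
    (K : Geometry.SimplicialComplex ℝ (EuclideanSpace ℝ (Fin d))) : Prop :=
  antipodalFaces (boundaryFaces i K) ⊆ boundaryFaces i K

/-- The sequence `Ts n = T, Ts (n-1), …, Ts 0` witnesses that the triangulation `T` of the
`n`-ball is aligned with hemispheres. (Values `Ts i` with `i > n` are irrelevant.) -/
structure IsHemisphereSequence {d : ℕ} (n : ℕ)
    (T : Geometry.SimplicialComplex ℝ (EuclideanSpace ℝ (Fin d)))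
    (Ts : ℕ → Geometry.SimplicialComplex ℝ (EuclideanSpace ℝ (Fin d))) : Prop where
  top_eq : Ts n = T
  ball : ∀ i ≤ n, IsBallTriangulation i (Ts i)
  symmetric : ∀ i ≤ n, AntipodallySymmetricOnBoundary i (Ts i)
  union_eq : ∀ i < n,
    (Ts i).faces ∪ antipodalFaces (Ts i).faces = boundaryFaces (i + 1) (Ts (i + 1))
  inter_eq : ∀ i < n,
    (Ts i).faces ∩ antipodalFaces (Ts i).faces = boundaryFaces i (Ts i)

/-! ### Labellings -/

/-- The set of `i`-labellings: multisets of `i + 1` labels. -/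
def labellings (L : Type*) (i : ℕ) : Set (Multiset L) :=
  {l | l.card = i + 1}

/-- The opposite labelling: every label is replaced by its opposite. -/
def oppositeLabelling {L : Type*} [Neg L] (l : Multiset L) : Multiset L :=
  l.map (fun a => -a)

/-- A set of labellings is strictly symmetric if it splits into pairs of (distinct) opposite
labellings: it is closed under opposites and contains no labelling which is its own opposite. -/
def StrictlySymmetric {L : Type*} [Neg L] (M : Set (Multiset L)) : Prop :=
  ∀ l ∈ M, oppositeLabelling l ∈ M ∧ oppositeLabelling l ≠ l

/-- `P` is the set of `+` labellings of a partitioning of `M`: it consists of exactly one labelling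
out of each pair of opposite labellings in `M`. -/
def IsPlusPart {L : Type*} [Neg L] (P M : Set (Multiset L)) : Prop :=
  P ⊆ M ∧ ∀ l ∈ M, (l ∈ P ∧ oppositeLabelling l ∉ P) ∨ (l ∉ P ∧ oppositeLabelling l ∈ P)

open Classical in
/-- The number of `i`-labellings contained in `l` that belong to `P`, counted with multiplicity
(i.e. the number of `i`-faces of a simplex labelled by `l` whose labelling is in `P`). -/
noncomputable def faceDegree {L : Type*} (i : ℕ) (P : Set (Multiset L)) (l : Multiset L) : ℕ :=
  (Multiset.powersetCard (i + 1) l).countP (fun l' => l' ∈ P)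

/-- The sets `Mⁱ`, for given forbidden labellings `F` and given sets `Mplus i` of `+` labellings:
`M⁰ = L⁰`, and `Mⁱ⁺¹` consists of the labellings in `Lⁱ⁺¹ \ F` that contain an odd number of
`i`-labellings from `Mplus i`. -/
def oddLabellings {L : Type*} (F : Set (Multiset L)) (Mplus : ℕ → Set (Multiset L)) :
    ℕ → Set (Multiset L)
  | 0 => labellings L 0
  | i + 1 => {l | l ∈ labellings L (i + 1) \ F ∧ Odd (faceDegree i (Mplus i) l)}

/-- The labelling of the simplex with vertex set `s` under the label function `lam`. -/
def simplexLabelling {V L : Type*} (lam : V → L) (s : Finset V) : Multiset L :=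
  s.val.map lam

/-! The theorem is an induction on `i` by two parity counts, one combinatorial and one geometric.

Combinatorial: in a simplex every face of codimension two lies in exactly two facets. Hence a
labelling of `i + 2` labels with no forbidden `i`-sublabelling has an even number of
`i`-sublabellings in `Mⁱ` (`even_faceDegree_oddLabellings`). As `Mⁱ` is the disjoint union of `Mⁱ₊`
and its opposite, this even number is the sum of the `Mⁱ₊`-counts of `ℓ` and of `-ℓ`. The two counts
have the same parity, so `Mⁱ⁺¹` is closed under opposites.

Geometric: count incidences between `(i + 1)`-simplices of `Tⁱ⁺¹` and their facets labelled in
`Mⁱ₊`. Interior facets are counted twice and boundary facets once, so the number of `(i +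
1)`-simplices labelled in `Mⁱ⁺¹` has the parity of the number of boundary `i`-simplices labelled in
`Mⁱ₊` (`IsBallTriangulation.odd_ncard_iff`). The boundary consists of `Tⁱ` and its reflection, and
reflection negates labels, so that number equals the number of `i`-simplices of `Tⁱ` labelled in
`Mⁱ` (`IsHemisphereSequence.ncard_boundary_eq`), which is odd by induction.

The topological input is `IsBallTriangulation.odd_ncard_cofaces_iff`: a facet has two cofaces in the
interior and one on the boundary. As the ball is given only up to homeomorphism, this rests on
invariance of domain, derived from Brouwer's fixed point theorem. -/

/-! ### Brouwer's fixed point theorem -/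

section Brouwer

open Metric Set MeasureTheory Filter Topology

/-- If every `p x` is the evaluation of a polynomial of degree at most `n` with coefficients depending on `x`,
then so is its integral, by Lagrange interpolation. -/
theorem exists_polynomial_integral_eq {α : Type*} [MeasurableSpace α] (μ : Measure α) (n : ℕ)
    (q : α → Polynomial ℝ) (hq : ∀ x, (q x).natDegree ≤ n)
    (hint : ∀ t : ℝ, Integrable (fun x => (q x).eval t) μ) :
    ∃ Q : Polynomial ℝ, ∀ t : ℝ, ∫ x, (q x).eval t ∂μ = Q.eval t := by
  classical
  let v : ℕ → ℝ := fun k => k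
  have hv : Set.InjOn v (Finset.range (n + 1) : Set ℕ) := fun a _ b _ h => Nat.cast_injective h
  refine ⟨∑ k ∈ Finset.range (n + 1),
    Polynomial.C (∫ x, (q x).eval (v k) ∂μ) * Lagrange.basis (Finset.range (n + 1)) v k, ?_⟩
  intro t
  have key : ∀ x, (q x).eval t = ∑ k ∈ Finset.range (n + 1),
      (q x).eval (v k) * (Lagrange.basis (Finset.range (n + 1)) v k).eval t := by
    intro x
    have h := Lagrange.eq_interpolate (f := q x) hv (by
      rw [Finset.card_range]
      exact lt_of_le_of_lt Polynomial.degree_le_natDegree (by exact_mod_cast Nat.lt_succ_of_le (hq x)))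
    conv_lhs => rw [h]
    simp [Lagrange.interpolate_apply, Polynomial.eval_finsetSum]
  simp_rw [key]
  rw [integral_finsetSum _ fun k _ => (hint (v k)).mul_const _]
  simp [Polynomial.eval_finsetSum, integral_mul_const]

variable {E : Type*} [NormedAddCommGroup E]

/-- The degree bound does not depend on `A`; this uniformity is what allows integration over a
family of operators in `exists_polynomial_integral_eq`. -/
theorem ContinuousLinearMap.exists_polynomial_det_one_add_smul [NormedSpace ℝ E]
    [FiniteDimensional ℝ E] (A : E →L[ℝ] E) :
    ∃ q : Polynomial ℝ, q.natDegree ≤ Module.finrank ℝ E ∧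
      ∀ t : ℝ, q.eval t = (1 + t • A).det := by
  classical
  let b := Module.finBasis ℝ E
  let M := LinearMap.toMatrix b b (A : E →ₗ[ℝ] E)
  refine ⟨Matrix.det ((Polynomial.X : Polynomial ℝ) • M.map Polynomial.C +
    (1 : Matrix _ _ ℝ).map Polynomial.C), ?_, ?_⟩
  · simpa using Polynomial.natDegree_det_X_add_C_le M 1
  · intro t
    have h : (1 + t • A).det = Matrix.det (1 + t • M) := by
      rw [ContinuousLinearMap.det, ← LinearMap.det_toMatrix b]
      congr 1
      simp [M, Module.End.one_eq_id]
    rw [h, ← Polynomial.coe_evalRingHom, RingHom.map_det]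
    congr 1
    ext i j
    by_cases hij : i = j <;> simp [hij, add_comm, mul_comm t]

/-- Along the segment `1 + t • A` every operator is invertible by the Neumann series, so the
determinant cannot change sign from its value `1` at `t = 0`. -/
theorem ContinuousLinearMap.det_one_add_pos [NormedSpace ℝ E] [FiniteDimensional ℝ E]
    (A : E →L[ℝ] E) (hA : ‖A‖ < 1) : 0 < (1 + A).det := by
  obtain ⟨q, -, hq⟩ := A.exists_polynomial_det_one_add_smul
  have hne : ∀ t ∈ Icc (0 : ℝ) 1, q.eval t ≠ 0 := by
    intro t ht h0
    rw [hq t] at h0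
    have hu : IsUnit (1 + t • A) := by
      have : ‖-(t • A)‖ < 1 := by
        rw [norm_neg, norm_smul, Real.norm_eq_abs, abs_of_nonneg ht.1]
        nlinarith [norm_nonneg A, ht.2]
      simpa using isUnit_one_sub_of_norm_lt_one this
    obtain ⟨u, hu⟩ := hu
    have hmul : LinearMap.det ((u : E →L[ℝ] E) : E →ₗ[ℝ] E) *
        LinearMap.det (((u⁻¹ : (E →L[ℝ] E)ˣ) : E →L[ℝ] E) : E →ₗ[ℝ] E) = 1 := by
      rw [← map_mul, ← LinearMap.det_id (A := ℝ) (M := E)]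
      congr 1
      exact congrArg (fun B : E →L[ℝ] E => (B : E →ₗ[ℝ] E)) u.mul_inv
    rw [hu, show LinearMap.det ((1 + t • A : E →L[ℝ] E) : E →ₗ[ℝ] E) = 0 from h0, zero_mul] at hmul
    exact zero_ne_one hmul
  have h1 : q.eval 1 = (1 + A).det := by simpa using hq 1
  have h00 : q.eval 0 = 1 := by rw [hq 0]; simp [ContinuousLinearMap.det]
  rw [← h1]
  by_contra hneg
  obtain ⟨t, ht, ht0⟩ := intermediate_value_Icc' (zero_le_one' ℝ) q.continuous.continuousOn
    (show (0 : ℝ) ∈ Icc (q.eval 1) (q.eval 0) from ⟨not_lt.1 hneg, by rw [h00]; norm_num⟩)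
  exact hne t ht ht0

/-- The extension by zero of a Lipschitz function on the unit ball that vanishes on the sphere. -/
theorem LipschitzOnWith.indicator_closedBall [NormedSpace ℝ E] {g : E → E} {C : NNReal}
    (hg : LipschitzOnWith C g (closedBall 0 1)) (h0 : ∀ x, ‖x‖ = 1 → g x = 0) :
    LipschitzWith C ((closedBall (0 : E) 1).indicator g) := by
  have key : ∀ x ∈ closedBall (0 : E) 1, ∀ y ∉ closedBall (0 : E) 1, ‖g x‖ ≤ C * dist x y := by
    intro x hx y hy
    rw [mem_closedBall_zero_iff] at hx hy
    -- The segment from `x` to `y` crosses the sphere, where `g` vanishes, so only the part inside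
    -- the ball contributes to the estimate.
    obtain ⟨s, hs, hs1⟩ := intermediate_value_Icc (zero_le_one' ℝ)
      (f := fun s : ℝ => ‖AffineMap.lineMap x y s‖) (by fun_prop)
      (show (1 : ℝ) ∈ Icc _ _ by simpa using ⟨hx, (not_le.1 hy).le⟩)
    have h1 := hg.dist_le_mul x (by simpa using hx) (AffineMap.lineMap x y s)
      (by rw [mem_closedBall_zero_iff]; exact hs1.le)
    rw [h0 _ hs1, dist_zero_right, dist_left_lineMap, Real.norm_of_nonneg hs.1] at h1
    refine h1.trans (mul_le_mul_of_nonneg_left ?_ C.2)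
    nlinarith [dist_nonneg (x := x) (y := y), hs.2]
  refine LipschitzWith.of_dist_le_mul fun x y => ?_
  by_cases hx : x ∈ closedBall (0 : E) 1 <;> by_cases hy : y ∈ closedBall (0 : E) 1
  · rw [indicator_of_mem hx, indicator_of_mem hy]
    exact hg.dist_le_mul x hx y hy
  · rw [indicator_of_mem hx, indicator_of_notMem hy, dist_zero_right]
    exact key x hx y hy
  · rw [indicator_of_notMem hx, indicator_of_mem hy, dist_zero_left, dist_comm]
    exact key y hy x hx
  · rw [indicator_of_notMem hx, indicator_of_notMem hy, dist_self]
    positivity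

/-- Solving `x + g x = y` amounts to finding the fixed point of the contraction `x ↦ y - g x`. -/
theorem bijective_add_of_lipschitzWith [CompleteSpace E] {g : E → E} {C : NNReal}
    (hg : LipschitzWith C g) (hC : C < 1) : Function.Bijective fun x => x + g x := by
  constructor
  · intro x y hxy
    have h := hg.dist_le_mul x y
    have hd : dist (g x) (g y) = dist x y := by
      rw [dist_eq_norm, dist_eq_norm, ← norm_neg]
      congr 1
      have : x + g x = y + g y := hxy
      rw [neg_sub, sub_eq_sub_iff_add_eq_add, add_comm, ← this, add_comm]
    rw [hd] at h
    have hC' : (C : ℝ) < 1 := hC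
    exact dist_le_zero.1 (by nlinarith [dist_nonneg (x := x) (y := y)])
  · intro y
    have hc : ContractingWith C fun x => y - g x :=
      ⟨hC, LipschitzWith.of_dist_le_mul fun a b => by
        rw [dist_sub_left]; exact hg.dist_le_mul a b⟩
    have hfix : y - g (hc.fixedPoint) = hc.fixedPoint := hc.fixedPoint_isFixedPt
    exact ⟨hc.fixedPoint, by
      change hc.fixedPoint + g hc.fixedPoint = y
      nth_rewrite 1 [← hfix]
      simp⟩

/-! ### The smooth no-retraction theorem and fixed points -/

variable [InnerProductSpace ℝ E] [FiniteDimensional ℝ E]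

/-- The Milnor–Rogers volume argument. With `g = r - id`, the integral of `det (1 + t Dg)` over the
ball is a polynomial in `t`. For small `t > 0` the map `x + t g x` permutes the ball, so the
polynomial is constantly the volume of the ball. At `t = 1` it is the integral of `det Dr`, which is
zero because `r` takes values in the sphere. -/
theorem not_exists_contDiff_retraction (r : E → E)
    (hr : ∀ x ∈ closedBall (0 : E) 1, ContDiffAt ℝ 1 r x) (hS : ∀ x, ‖x‖ = 1 → r x = x)
    (hB : ∀ x ∈ closedBall (0 : E) 1, ‖r x‖ = 1) : False := by
  borelize E
  have hcomp : IsCompact (closedBall (0 : E) 1) := isCompact_closedBall 0 1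
  set g : E → E := fun x => r x - x with hg
  have hgd : ∀ x ∈ closedBall (0 : E) 1, ContDiffAt ℝ 1 g x := fun x hx =>
    (hr x hx).sub contDiffAt_id
  have hgc : ContinuousOn (fderiv ℝ g) (closedBall 0 1) := fun x hx =>
    ((hgd x hx).fderiv_right (m := 0) (by norm_num)).continuousAt.continuousWithinAt
  obtain ⟨C₀, hC₀⟩ := hcomp.exists_bound_of_continuousOn hgc
  set C : NNReal := (max C₀ 0).toNNReal with hCdef
  have hC : ∀ x ∈ closedBall (0 : E) 1, ‖fderiv ℝ g x‖ ≤ C := fun x hx => by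
    rw [hCdef, Real.coe_toNNReal _ (le_max_right _ _)]
    exact (hC₀ x hx).trans (le_max_left _ _)
  have hlip : LipschitzOnWith C g (closedBall 0 1) :=
    (convex_closedBall (0 : E) 1).lipschitzOnWith_of_nnnorm_fderiv_le
      (fun x hx => (hgd x hx).differentiableAt (by norm_num)) fun x hx => hC x hx
  have hlip' := hlip.indicator_closedBall fun x hx => by simp [hg, hS x hx]
  set G := (closedBall (0 : E) 1).indicator g with hG
  have hG0 : ∀ x ∉ ball (0 : E) 1, G x = 0 := by
    intro x hx
    by_cases h : x ∈ closedBall (0 : E) 1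
    · rw [hG, indicator_of_mem h]
      rw [mem_closedBall_zero_iff] at h
      rw [mem_ball_zero_iff, not_lt] at hx
      simp [hg, hS x (le_antisymm h hx)]
    · rw [hG, indicator_of_notMem h]
  have hGg : ∀ x ∈ ball (0 : E) 1, G x = g x := fun x hx => by
    rw [hG, indicator_of_mem (ball_subset_closedBall hx)]
  choose q hqdeg hq using fun x => (fderiv ℝ g x).exists_polynomial_det_one_add_smul
  have hint : ∀ t : ℝ, Integrable (fun x => (q x).eval t)
      ((volume : Measure E).restrict (ball 0 1)) := by
    intro t
    have hc : ContinuousOn (fun x => (q x).eval t) (closedBall (0 : E) 1) := by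
      simp_rw [hq]
      have := (ContinuousLinearMap.continuous_det (𝕜 := ℝ) (E := E)).comp_continuousOn
        ((continuousOn_const (c := (1 : E →L[ℝ] E))).add (hgc.const_smul t))
      exact this
    exact (hc.integrableOn_compact hcomp).mono_set ball_subset_closedBall
  obtain ⟨Q, hQ⟩ := exists_polynomial_integral_eq _ _ q hqdeg hint
  have hsmall : ∀ t : ℝ, 0 < t → t * C < 1 → Q.eval t = (volume : Measure E).real (ball 0 1) := by
    intro t ht htC
    set f : E → E := fun x => x + t • G x with hf
    have hbij : Function.Bijective f := by
      refine bijective_add_of_lipschitzWith (C := t.toNNReal * C)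
        (LipschitzWith.of_dist_le_mul fun x y => ?_) ?_
      · rw [dist_smul₀, Real.norm_of_nonneg ht.le, NNReal.coe_mul, Real.coe_toNNReal _ ht.le,
          mul_assoc]
        exact mul_le_mul_of_nonneg_left (hlip'.dist_le_mul x y) ht.le
      · rw [← NNReal.coe_lt_coe]
        simpa [Real.coe_toNNReal _ ht.le] using htC
    have hfix : ∀ x ∉ ball (0 : E) 1, f x = x := fun x hx => by simp [hf, hG0 x hx]
    have himg : f '' ball 0 1 = ball 0 1 := by
      apply Subset.antisymm
      · rintro _ ⟨x, hx, rfl⟩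
        by_contra h
        exact h (by rw [hbij.1 (hfix _ h)]; exact hx)
      · intro y hy
        obtain ⟨x, rfl⟩ := hbij.2 y
        by_contra h
        have hx : x ∉ ball (0 : E) 1 := fun hx => h ⟨x, hx, rfl⟩
        exact hx (hfix x hx ▸ hy)
    have hderiv : ∀ x ∈ ball (0 : E) 1,
        HasFDerivWithinAt f (1 + t • fderiv ℝ g x) (ball 0 1) x := by
      intro x hx
      have h1 : HasFDerivAt (fun x => x + t • g x) (1 + t • fderiv ℝ g x) x :=
        (hasFDerivAt_id x).add
          (((hgd x (ball_subset_closedBall hx)).differentiableAt (by norm_num)).hasFDerivAt.const_smul t)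
      exact h1.hasFDerivWithinAt.congr (fun y hy => by simp [hf, hGg y hy]) (by simp [hf, hGg x hx])
    have hcv := integral_image_eq_integral_abs_det_fderiv_smul (volume : Measure E)
      measurableSet_ball hderiv hbij.1.injOn fun _ => (1 : ℝ)
    rw [himg] at hcv
    rw [← hQ t]
    trans ∫ x in ball (0 : E) 1, |(1 + t • fderiv ℝ g x).det| • (1 : ℝ)
    · refine setIntegral_congr_fun measurableSet_ball fun x hx => ?_
      have hpos : 0 < (1 + t • fderiv ℝ g x).det := by
        apply ContinuousLinearMap.det_one_add_pos
        rw [norm_smul, Real.norm_of_nonneg ht.le]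
        exact (mul_le_mul_of_nonneg_left (hC x (ball_subset_closedBall hx)) ht.le).trans_lt htC
      simp [hq, abs_of_pos hpos]
    · rw [← hcv]
      simp
  have hQconst : Q = Polynomial.C ((volume : Measure E).real (ball 0 1)) := by
    -- The bound `1 / (C + 1)` ensures `t * C < 1` also when `C = 0`.
    refine Polynomial.eq_of_infinite_eval_eq _ _ ((Ioo_infinite
      (show (0 : ℝ) < 1 / (C + 1) by positivity)).mono fun t ht => ?_)
    have hC1 : (0 : ℝ) < C + 1 := by positivity
    have := (lt_div_iff₀ hC1).1 ht.2
    simpa using hsmall t ht.1 (by nlinarith [ht.1])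
  have hone : Q.eval 1 = 0 := by
    rw [← hQ 1]
    refine (setIntegral_congr_fun measurableSet_ball fun x hx => ?_).trans (integral_zero E ℝ)
    change (q x).eval 1 = 0
    have hxc := ball_subset_closedBall hx
    have hrd : HasFDerivAt r (1 + (1 : ℝ) • fderiv ℝ g x) x := by
      have h1 := ((hgd x hxc).differentiableAt (by norm_num)).hasFDerivAt.add (hasFDerivAt_id x)
      have e : g + id = r := by ext; simp [hg]
      rw [e] at h1
      convert h1 using 1
      simp [add_comm, ContinuousLinearMap.one_def]
    rw [hq]
    set A := (1 + (1 : ℝ) • fderiv ℝ g x)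
    by_contra hdet
    have hu : IsUnit (LinearMap.det (A : E →ₗ[ℝ] E)) := isUnit_iff_ne_zero.2 hdet
    -- If `Dr` were onto, some `v` would satisfy `Dr v = r x`; the derivative of the constant `‖r‖ ^
    -- 2` along `v` would then be `2 ‖r x‖ ^ 2 = 2`.
    obtain ⟨v, hv⟩ := ((LinearMap.isUnit_iff_range_eq_top _).1
      ((LinearMap.isUnit_iff_isUnit_det _).2 hu) |> LinearMap.range_eq_top.1) (r x)
    have hsq : HasFDerivAt (fun y => ‖r y‖ ^ 2) (0 : E →L[ℝ] ℝ) x := by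
      refine (hasFDerivAt_const (1 : ℝ) x).congr_of_eventuallyEq ?_
      filter_upwards [isOpen_ball.mem_nhds hx] with y hy
      rw [hB y (ball_subset_closedBall hy), one_pow]
    have h2 := congrArg (fun B : E →L[ℝ] ℝ => B v) (hsq.unique hrd.norm_sq)
    have hv' : A v = r x := hv
    simp [hv', hB x hxc] at h2
  have hvol : 0 < (volume : Measure E).real (ball 0 1) :=
    ENNReal.toReal_pos (measure_ball_pos _ _ one_pos).ne' measure_ball_lt_top.ne
  rw [hQconst, Polynomial.eval_C] at hone
  exact hvol.ne' hone

/-- Without a fixed point, the ray from `P x` through `x` leaves the ball at a point depending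
smoothly on `x`, which gives a retraction onto the sphere. Here `τ` is the larger root of the
quadratic equation `‖x + τ d‖ ^ 2 = 1`. The strict bound on `P` keeps the discriminant positive up
to the sphere, so that its square root is smooth there. -/
theorem exists_fixedPoint_closedBall_of_contDiff {P : E → E} (hP : ContDiff ℝ 1 P)
    (hP1 : ∀ x ∈ closedBall (0 : E) 1, ‖P x‖ < 1) : ∃ x ∈ closedBall (0 : E) 1, P x = x := by
  by_contra! hne
  set d : E → E := fun x => x - P x with hd
  have hd0 : ∀ x ∈ closedBall (0 : E) 1, 0 < ‖d x‖ ^ 2 := fun x hx => by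
    have : d x ≠ 0 := sub_ne_zero.2 (hne x hx).symm
    positivity
  have hdc : ContDiff ℝ 1 d := contDiff_id.sub hP
  set b : E → ℝ := fun x => inner ℝ x (d x) with hb
  set D : E → ℝ := fun x => b x ^ 2 + ‖d x‖ ^ 2 * (1 - ‖x‖ ^ 2) with hD
  set τ : E → ℝ := fun x => (-b x + √(D x)) / ‖d x‖ ^ 2 with hτ
  have hbS : ∀ x : E, ‖x‖ = 1 → 0 < b x := fun x hx => by
    have h1 : inner ℝ x (P x) ≤ ‖x‖ * ‖P x‖ := real_inner_le_norm _ _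
    have h2 := hP1 x (by simp [hx])
    have h3 : b x = ‖x‖ ^ 2 - inner ℝ x (P x) := by
      simp only [hb, hd, inner_sub_right, real_inner_self_eq_norm_sq]
    rw [h3]; rw [hx] at h1 ⊢; linarith
  have hDpos : ∀ x ∈ closedBall (0 : E) 1, 0 < D x := fun x hx => by
    have hx' : ‖x‖ ≤ 1 := by simpa using hx
    rcases hx'.lt_or_eq with h | h
    · have : 0 < 1 - ‖x‖ ^ 2 := by nlinarith [norm_nonneg x]
      have := mul_pos (hd0 x hx) this
      have := sq_nonneg (b x)
      simp only [hD]; linarith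
    · have := hbS x h
      simp only [hD, h]
      norm_num
      positivity
  have hbc : ContDiff ℝ 1 b := contDiff_id.inner ℝ hdc
  have hDc : ContDiff ℝ 1 D :=
    (hbc.pow 2).add ((hdc.norm_sq ℝ).mul (contDiff_const.sub (contDiff_id.norm_sq ℝ)))
  refine not_exists_contDiff_retraction (fun x => x + τ x • d x) (fun x hx => ?_) (fun x hx => ?_)
    (fun x hx => ?_)
  · exact contDiffAt_id.add ((((hbc.contDiffAt.neg).add
      (hDc.contDiffAt.sqrt (hDpos x hx).ne')).div (hdc.norm_sq ℝ).contDiffAt (hd0 x hx).ne').smul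
        hdc.contDiffAt)
  · have : τ x = 0 := by
      simp [hτ, hD, hx, Real.sqrt_sq (hbS x hx).le]
    simp [this]
  · have h1 : ‖d x‖ ^ 2 * τ x + b x = √(D x) := by
      have := (hd0 x hx).ne'
      simp only [hτ]
      rw [mul_div_cancel₀ _ this]
      ring
    have h2 : (‖d x‖ ^ 2 * τ x + b x) ^ 2 = D x := by
      rw [h1, Real.sq_sqrt (hDpos x hx).le]
    have h3 : ‖x + τ x • d x‖ ^ 2 = ‖x‖ ^ 2 + 2 * (τ x * b x) + τ x ^ 2 * ‖d x‖ ^ 2 := by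
      rw [norm_add_sq_real, inner_smul_right, norm_smul, mul_pow, Real.norm_eq_abs, sq_abs]
    have h4 : ‖x + τ x • d x‖ ^ 2 = 1 := by
      rw [h3]
      have := (hd0 x hx).ne'
      apply mul_left_cancel₀ this
      simp only [hD] at h2
      linear_combination h2
    nlinarith [norm_nonneg (x + τ x • d x)]

/-- **Brouwer's fixed point theorem**. -/
theorem exists_fixedPoint_closedBall {f : E → E} (hf : ContinuousOn f (closedBall 0 1))
    (hm : MapsTo f (closedBall 0 1) (closedBall 0 1)) : ∃ x ∈ closedBall (0 : E) 1, f x = x := by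
  by_contra! hne
  obtain ⟨x₀, hx₀, hmin⟩ := (isCompact_closedBall (0 : E) 1).exists_isMinOn ⟨0, by simp⟩
    (hf.sub continuousOn_id).norm
  set δ : ℝ := ‖f x₀ - x₀‖ / 2 with hδ
  have hδ0 : 0 < δ := half_pos (norm_pos_iff.2 (sub_ne_zero.2 (hne x₀ hx₀)))
  obtain ⟨F, hF⟩ := ContinuousMap.exists_restrict_eq (isClosed_closedBall (x := (0 : E)) (ε := 1))
    ⟨_, hf.domRestrict⟩
  have hFf : ∀ x ∈ closedBall (0 : E) 1, F x = f x := fun x hx =>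
    congrArg (fun h => h ⟨x, hx⟩) hF
  obtain ⟨P, hP, hPF, -⟩ := F.continuous.exists_contDiff_approx 1 (continuous_const (y := δ))
    fun _ => hδ0
  have hPf : ∀ x ∈ closedBall (0 : E) 1, ‖P x - f x‖ < δ := fun x hx => by
    rw [← hFf x hx, ← dist_eq_norm]; exact hPF x
  -- Dividing by `1 + δ` brings the smooth approximation back into the open ball. Its fixed point is
  -- displaced by `f` by less than `2 * δ`, the minimal displacement.
  obtain ⟨x, hx, hfix⟩ := exists_fixedPoint_closedBall_of_contDiff (P := fun x => (1 + δ)⁻¹ • P x)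
    (contDiff_const.smul (by exact_mod_cast hP)) fun x hx => by
      rw [norm_smul, Real.norm_of_nonneg (by positivity), inv_mul_lt_iff₀ (by positivity), mul_one]
      have h1 : ‖f x‖ ≤ 1 := by simpa using hm hx
      have h2 := norm_sub_norm_le (P x) (f x)
      have := hPf x hx
      linarith
  have hfix' : P x = (1 + δ) • x := by
    rw [← hfix, smul_inv_smul₀ (by positivity)]
    simp only [hfix]
  have h1 : 2 * δ ≤ ‖f x - x‖ := by
    have := hmin hx
    have : ‖f x₀ - x₀‖ ≤ ‖f x - x‖ := this
    linarith
  have h2 : ‖f x - x‖ ≤ ‖P x - f x‖ + δ * ‖x‖ := by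
    have e : f x - x = -(P x - f x) + δ • x := by rw [hfix']; module
    rw [e]
    refine (norm_add_le _ _).trans ?_
    rw [norm_neg, norm_smul, Real.norm_of_nonneg hδ0.le]
  have h3 : ‖x‖ ≤ 1 := by simpa using hx
  have := hPf x hx
  nlinarith

end Brouwer
/-! ### Invariance of domain -/

section InvarianceOfDomain

open Metric Set MeasureTheory Filter Topology

/-- Extend the inverse of `f` to a continuous `G`. By Brouwer, a small continuous perturbation of
`G` on the image still has a zero there. If `f 0` were not interior, the image could be pushed
radially away from a nearby missing point `c`; composing with a smooth approximation of `G` and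
shifting by a small generic vector would give a perturbation without zeros. -/
theorem mem_interior_image_closedBall {E : Type*} [NormedAddCommGroup E] [InnerProductSpace ℝ E]
    [FiniteDimensional ℝ E] {f : E → E} (hf : ContinuousOn f (closedBall 0 1))
    (hinj : InjOn f (closedBall 0 1)) : f 0 ∈ interior (f '' closedBall 0 1) := by
  borelize E
  have hcomp : IsCompact (f '' closedBall 0 1) := (isCompact_closedBall (0 : E) 1).image_of_continuousOn hf
  have : CompactSpace (closedBall (0 : E) 1) := isCompact_iff_compactSpace.1 (isCompact_closedBall 0 1)
  obtain ⟨G, hG⟩ := ContinuousMap.exists_extension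
    (hf.domRestrict.isClosedEmbedding (injOn_iff_injective.1 hinj))
    (⟨Subtype.val, continuous_subtype_val⟩ : C(closedBall (0 : E) 1, E))
  have hGf : ∀ x ∈ closedBall (0 : E) 1, G (f x) = x := fun x hx =>
    congrArg (fun h => h ⟨x, hx⟩) hG
  have hG0 : G (f 0) = 0 := hGf 0 (by simp)
  have stable : ∀ H : E → E, ContinuousOn H (f '' closedBall 0 1) →
      (∀ y ∈ f '' closedBall 0 1, ‖G y - H y‖ ≤ 1) → ∃ y ∈ f '' closedBall 0 1, H y = 0 := by
    intro H hH hGH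
    obtain ⟨x, hx, hfix⟩ := exists_fixedPoint_closedBall (f := fun x => x - H (f x))
      (continuousOn_id.sub (hH.comp hf (mapsTo_image f _))) (fun x hx => by
        have := hGH (f x) (mem_image_of_mem f hx)
        rw [hGf x hx] at this
        simpa using this)
    exact ⟨f x, mem_image_of_mem f hx, by simpa using hfix⟩
  by_contra hint
  -- The radius `2 * ε` about `f 0` covers the closed ball of radius `ε` about the point `c` chosen
  -- next.
  obtain ⟨ε, hε, hGε⟩ : ∃ ε > 0, ∀ y, dist y (f 0) < 2 * ε → ‖G y‖ ≤ 1 / 10 := by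
    obtain ⟨η, hη, h⟩ := Metric.continuous_iff.1 G.continuous (f 0) (1 / 10) (by norm_num)
    refine ⟨η / 2, half_pos hη, fun y hy => ?_⟩
    have := h y (by linarith)
    rw [hG0, dist_zero_right] at this
    exact this.le
  obtain ⟨c, hcK, hc⟩ : ∃ c ∈ (f '' closedBall 0 1)ᶜ, dist (f 0) c < ε := by
    refine Metric.mem_closure_iff.1 ?_ ε hε
    rwa [closure_compl]
  obtain ⟨δ, hδ0, hδ1, hδ⟩ : ∃ δ > 0, δ ≤ 1 / 10 ∧
      ∀ y ∈ f '' closedBall 0 1, ε ≤ dist y c → δ ≤ ‖G y‖ := by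
    have hK₁ : IsCompact (f '' closedBall 0 1 ∩ {y | ε ≤ dist y c}) :=
      hcomp.inter_right (isClosed_le continuous_const (by fun_prop))
    obtain ⟨δ, hδ, h⟩ := hK₁.exists_forall_le' (f := fun y => ‖G y‖) (by fun_prop) (a := 0) (by
      rintro _ ⟨⟨x, hx, rfl⟩, hy⟩
      rw [norm_pos_iff, hGf x hx]
      rintro rfl
      exact absurd hc (not_lt.2 hy))
    exact ⟨min δ (1 / 10), lt_min hδ (by norm_num), min_le_right _ _, fun y hy hyc =>
      (min_le_left _ _).trans (h y ⟨hy, hyc⟩)⟩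
  obtain ⟨P, hP, hPG, -⟩ := G.continuous.exists_contDiff_approx 1 (continuous_const (y := δ / 2))
    fun _ => half_pos hδ0
  have hPnull : (volume : Measure E) (P '' sphere c ε) = 0 :=
    addHaar_image_eq_zero_of_differentiableOn_of_addHaar_eq_zero _
      (hP.differentiable (by norm_num)).differentiableOn (Measure.addHaar_sphere_of_ne_zero _ c hε.ne')
  -- The sphere about `c` need not lie in the image of `f`, so `P` may vanish on it. Since `P` is
  -- smooth, the image of the sphere is null, and a small shift `v` avoids it.
  obtain ⟨v, hv, hvP⟩ : ∃ v ∈ ball (0 : E) (δ / 2), v ∉ P '' sphere c ε := by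
    refine not_subset.1 fun h => ?_
    exact (measure_ball_pos (volume : Measure E) 0 (half_pos hδ0)).ne' (measure_mono_null h hPnull)
  rw [mem_ball_zero_iff] at hv
  set Φ : E → E := fun y => c + max (ε / ‖y - c‖) 1 • (y - c) with hΦ
  have hpos : ∀ y ∈ f '' closedBall 0 1, 0 < ‖y - c‖ := fun y hy =>
    norm_pos_iff.2 (sub_ne_zero.2 fun h => hcK (h ▸ hy))
  have hfar : ∀ y ∈ f '' closedBall 0 1, ε ≤ dist y c → Φ y = y := fun y hy h => by
    rw [dist_eq_norm] at h
    simp [hΦ, max_eq_right ((div_le_one (hpos y hy)).2 h)]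
  have hnear : ∀ y ∈ f '' closedBall 0 1, dist y c < ε → Φ y ∈ sphere c ε := fun y hy h => by
    rw [dist_eq_norm] at h
    simp [hΦ, max_eq_left ((one_le_div (hpos y hy)).2 h.le), norm_smul, abs_of_pos hε,
      (hpos y hy).ne']
  have hPG' : ∀ y, ‖G y - P y‖ < δ / 2 := fun y => by
    rw [← dist_eq_norm, dist_comm]; exact hPG y
  obtain ⟨y, hy, hy0⟩ := stable (fun y => P (Φ y) - v) (by
    refine (hP.continuous.comp_continuousOn ?_).sub continuousOn_const
    refine continuousOn_const.add (ContinuousOn.smul (ContinuousOn.sup ?_ continuousOn_const)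
      (by fun_prop))
    exact continuousOn_const.div (by fun_prop) fun y hy => (hpos y hy).ne') (fun y hy => by
    rcases le_or_gt ε (dist y c) with h | h
    · rw [hfar y hy h, show G y - (P y - v) = (G y - P y) + v by abel]
      have := norm_add_le (G y - P y) v
      have := hPG' y
      linarith
    · have h1 : ‖G y‖ ≤ 1 / 10 := hGε y (by
        have := dist_triangle_right y (f 0) c; linarith)
      have h2 : ‖G (Φ y)‖ ≤ 1 / 10 := hGε _ (by
        have := dist_triangle_right (Φ y) (f 0) c
        have e : dist (Φ y) c = ε := hnear y hy h
        linarith)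
      have h3 := hPG' (Φ y)
      rw [show G y - (P (Φ y) - v) = G y - G (Φ y) + (G (Φ y) - P (Φ y)) + v by abel]
      have h4 := norm_add₃_le (a := G y - G (Φ y)) (b := G (Φ y) - P (Φ y)) (c := v)
      have h5 := norm_sub_le (G y) (G (Φ y))
      linarith)
  have hPv : P (Φ y) = v := sub_eq_zero.1 hy0
  rcases le_or_gt ε (dist y c) with h | h
  · rw [hfar y hy h] at hPv
    have h1 := hδ y hy h
    have h2 := norm_add_le (G y - P y) (P y)
    rw [sub_add_cancel, hPv] at h2
    have h3 := hPG' y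
    rw [hPv] at h3
    linarith
  · exact hvP ⟨Φ y, hnear y hy h, hPv⟩

variable {E F : Type*} [NormedAddCommGroup E] [NormedSpace ℝ E] [FiniteDimensional ℝ E]
  [NormedAddCommGroup F] [NormedSpace ℝ F] [FiniteDimensional ℝ F]

/-- **Invariance of domain**. -/
theorem ContinuousOn.isOpen_image_of_injOn_of_finrank_eq
    (hEF : Module.finrank ℝ E = Module.finrank ℝ F) {f : E → F} {U : Set E} (hf : ContinuousOn f U)
    (hU : IsOpen U) (hinj : InjOn f U) : IsOpen (f '' U) := by
  let e : E ≃L[ℝ] EuclideanSpace ℝ (Fin (Module.finrank ℝ E)) :=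
    ContinuousLinearEquiv.ofFinrankEq (by simp)
  let e' : F ≃L[ℝ] EuclideanSpace ℝ (Fin (Module.finrank ℝ E)) :=
    ContinuousLinearEquiv.ofFinrankEq (by simp [hEF])
  rw [← e'.toHomeomorph.isOpen_image, isOpen_iff_mem_nhds]
  rintro _ ⟨_, ⟨x, hx, rfl⟩, rfl⟩
  have hU' : IsOpen (e.symm ⁻¹' U) := hU.preimage e.symm.continuous
  obtain ⟨r, hr, hball⟩ := Metric.nhds_basis_closedBall.mem_iff.1
    (hU'.mem_nhds (show e x ∈ e.symm ⁻¹' U by simpa using hx))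
  have hmaps : MapsTo (fun y => e.symm (e x + r • y)) (closedBall 0 1) U := fun y hy => by
    refine hball ?_
    rw [mem_closedBall_zero_iff] at hy
    simp only [mem_closedBall, dist_self_add_left, norm_smul, Real.norm_of_nonneg hr.le]
    nlinarith
  have h := mem_interior_image_closedBall (f := fun y => e' (f (e.symm (e x + r • y))))
    (e'.continuous.comp_continuousOn (hf.comp (by fun_prop) hmaps)) (fun y hy z hz hyz => by
      have h1 := hinj (hmaps hy) (hmaps hz) (e'.injective hyz)
      exact smul_right_injective _ hr.ne' (add_left_cancel (e.symm.injective h1)))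
  rw [mem_interior_iff_mem_nhds] at h
  simp only [smul_zero, add_zero, ContinuousLinearEquiv.symm_apply_apply] at h
  refine mem_of_superset h ?_
  rintro _ ⟨y, hy, rfl⟩
  exact ⟨_, ⟨_, hmaps hy, rfl⟩, rfl⟩

/-- **Invariance of dimension**. -/
theorem ContinuousOn.finrank_le_of_injOn {f : E → F} {U : Set E} (hf : ContinuousOn f U)
    (hU : IsOpen U) (hne : U.Nonempty) (hinj : InjOn f U) :
    Module.finrank ℝ E ≤ Module.finrank ℝ F := by
  by_contra! hlt
  obtain ⟨k, hk⟩ := Nat.exists_eq_add_of_lt hlt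
  obtain ⟨x, hx⟩ := hne
  -- Padding with zeros equalizes the dimensions; the image would be open although it lies in the
  -- slice `F × {0}`.
  have hopen := ContinuousOn.isOpen_image_of_injOn_of_finrank_eq
    (F := F × EuclideanSpace ℝ (Fin (k + 1))) (by simp [hk, add_assoc])
    (f := fun y => (f y, 0)) (hf.prodMk continuousOn_const) hU fun y hy z hz hyz =>
      hinj hy hz (congrArg Prod.fst hyz)
  have hopen' : IsOpen ((fun v : EuclideanSpace ℝ (Fin (k + 1)) => (f x, v)) ⁻¹'
      ((fun y => (f y, (0 : EuclideanSpace ℝ (Fin (k + 1))))) '' U)) :=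
    hopen.preimage (by fun_prop)
  have heq : (fun v : EuclideanSpace ℝ (Fin (k + 1)) => (f x, v)) ⁻¹'
      ((fun y => (f y, (0 : EuclideanSpace ℝ (Fin (k + 1))))) '' U) = {0} := by
    ext v
    constructor
    · rintro ⟨y, -, hy⟩
      exact (congrArg Prod.snd hy).symm
    · rintro rfl
      exact ⟨x, hx, rfl⟩
  rw [heq] at hopen'
  exact not_isOpen_singleton (0 : EuclideanSpace ℝ (Fin (k + 1))) hopen'

end InvarianceOfDomain
/-! ### Functions with sum zero -/

section SumZero

variable {V : Type*}

/-- The functions on `t` with sum zero. -/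
def sumZero (t : Finset V) : Submodule ℝ (t → ℝ) :=
  LinearMap.ker (∑ y, LinearMap.proj y : (t → ℝ) →ₗ[ℝ] ℝ)

theorem mem_sumZero {t : Finset V} {v : t → ℝ} : v ∈ sumZero t ↔ ∑ y, v y = 0 := by
  simp [sumZero]

theorem finrank_sumZero_add_one {t : Finset V} (ht : t.Nonempty) :
    Module.finrank ℝ (sumZero t) + 1 = t.card := by
  classical
  have h := LinearMap.finrank_range_add_finrank_ker (∑ y, LinearMap.proj y : (t → ℝ) →ₗ[ℝ] ℝ)
  have hsurj : LinearMap.range (∑ y, LinearMap.proj y : (t → ℝ) →ₗ[ℝ] ℝ) = ⊤ := by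
    rw [LinearMap.range_eq_top]
    obtain ⟨a, ha⟩ := ht
    intro r
    exact ⟨Pi.single ⟨a, ha⟩ r, by simp⟩
  rw [hsurj, finrank_top] at h
  simp only [Module.finrank_self, Module.finrank_fintype_fun_eq_card, Fintype.card_coe] at h
  rw [sumZero]
  omega

open Classical in
/-- The extension by zero of a function on `t`. -/
noncomputable def zeroExtend (t : Finset V) (v : t → ℝ) (y : V) : ℝ :=
  if h : y ∈ t then v ⟨y, h⟩ else 0

theorem zeroExtend_of_notMem {t : Finset V} (v : t → ℝ) {y : V} (hy : y ∉ t) :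
    zeroExtend t v y = 0 := dif_neg hy

theorem zeroExtend_coe {t : Finset V} (v : t → ℝ) (y : t) : zeroExtend t v y = v y :=
  dif_pos y.2

theorem sum_zeroExtend {t : Finset V} {v : t → ℝ} (hv : v ∈ sumZero t) :
    ∑ y ∈ t, zeroExtend t v y = 0 := by
  rw [← Finset.sum_coe_sort]
  simpa [zeroExtend_coe] using mem_sumZero.1 hv

@[fun_prop]
theorem continuous_zeroExtend (t : Finset V) (y : V) :
    Continuous fun v : sumZero t => zeroExtend t v y := by
  by_cases h : y ∈ t
  · simp only [zeroExtend, h, dite_true]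
    exact (continuous_apply _).comp continuous_subtype_val
  · simp only [zeroExtend, h, dite_false]
    exact continuous_const

theorem zeroExtend_injective (t : Finset V) : Function.Injective (zeroExtend t) := fun v v' h => by
  ext y
  rw [← zeroExtend_coe v y, h, zeroExtend_coe]

end SumZero

/-! ### Barycentric weights -/

section Barycentric

open Set Filter Topology

variable {V : Type*} [AddCommGroup V] [Module ℝ V]

/-- `w` is a system of barycentric coordinates of the point `x` of the simplex with vertex set `t`. -/
structure IsBarycentric (t : Finset V) (w : V → ℝ) (x : V) : Prop where
  eq_zero : ∀ y ∉ t, w y = 0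
  nonneg : ∀ y, 0 ≤ w y
  sum_eq : ∑ y ∈ t, w y = 1
  sum_smul_eq : ∑ y ∈ t, w y • y = x

theorem IsBarycentric.mono {s t : Finset V} {w : V → ℝ} {x : V} (h : IsBarycentric s w x)
    (hst : s ⊆ t) : IsBarycentric t w x where
  eq_zero y hy := h.eq_zero y fun hs => hy (hst hs)
  nonneg := h.nonneg
  sum_eq := by
    rw [← h.sum_eq]
    exact (Finset.sum_subset hst fun y _ hy => h.eq_zero y hy).symm
  sum_smul_eq := by
    rw [← h.sum_smul_eq]
    exact (Finset.sum_subset hst fun y _ hy => by rw [h.eq_zero y hy, zero_smul]).symm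

theorem mem_convexHull_iff_exists_isBarycentric {t : Finset V} {x : V} :
    x ∈ convexHull ℝ (t : Set V) ↔ ∃ w, IsBarycentric t w x := by
  classical
  rw [Finset.mem_convexHull']
  constructor
  · rintro ⟨w, h0, h1, hx⟩
    refine ⟨fun y => if y ∈ t then w y else 0, fun y hy => if_neg hy, fun y => ?_, ?_, ?_⟩
    · split_ifs with h
      exacts [h0 y h, le_rfl]
    · rw [← h1]
      exact Finset.sum_congr rfl fun y hy => if_pos hy
    · rw [← hx]
      exact Finset.sum_congr rfl fun y hy => by rw [if_pos hy]
  · rintro ⟨w, hw⟩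
    exact ⟨w, fun y _ => hw.nonneg y, hw.sum_eq, hw.sum_smul_eq⟩

theorem IsBarycentric.mem_convexHull {t : Finset V} {w : V → ℝ} {x : V}
    (h : IsBarycentric t w x) : x ∈ convexHull ℝ (t : Set V) :=
  mem_convexHull_iff_exists_isBarycentric.2 ⟨w, h⟩

theorem IsBarycentric.combo {t : Finset V} {w w' : V → ℝ} {x x' : V} (h : IsBarycentric t w x)
    (h' : IsBarycentric t w' x') {a b : ℝ} (ha : 0 ≤ a) (hb : 0 ≤ b) (hab : a + b = 1) :
    IsBarycentric t (fun y => a * w y + b * w' y) (a • x + b • x') where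
  eq_zero y hy := by rw [h.eq_zero y hy, h'.eq_zero y hy]; simp
  nonneg y := add_nonneg (mul_nonneg ha (h.nonneg y)) (mul_nonneg hb (h'.nonneg y))
  sum_eq := by
    rw [Finset.sum_add_distrib, ← Finset.mul_sum, ← Finset.mul_sum, h.sum_eq, h'.sum_eq]
    simpa using hab
  sum_smul_eq := by
    simp_rw [add_smul, mul_smul]
    rw [Finset.sum_add_distrib, ← Finset.smul_sum, ← Finset.smul_sum, h.sum_smul_eq, h'.sum_smul_eq]

theorem isBarycentric_vertex [DecidableEq V] {a : V} : IsBarycentric {a} (fun y => if y = a then 1 else 0) a where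
  eq_zero y hy := if_neg (by simpa using hy)
  nonneg y := by split_ifs <;> norm_num
  sum_eq := by simp
  sum_smul_eq := by simp

theorem exists_isBarycentric_pos {s : Finset V} (hs : s.Nonempty) :
    ∃ w x, IsBarycentric s w x ∧ ∀ y ∈ s, 0 < w y := by
  classical
  have hc : (0 : ℝ) < s.card := by exact_mod_cast hs.card_pos
  refine ⟨fun y => if y ∈ s then (s.card : ℝ)⁻¹ else 0, _,
    ⟨fun y hy => if_neg hy, fun y => ?_, ?_, rfl⟩, fun y hy => ?_⟩
  · split_ifs <;> positivity
  · rw [Finset.sum_congr rfl fun y hy => if_pos hy]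
    simp [hc.ne']
  · simp only [if_pos hy]; positivity

/-- Nonnegativity of the weights is not required: the lemma is also applied to a point just beyond a
facet, which has a negative coordinate. -/
theorem AffineIndependent.eq_of_sum_eq {t : Finset V} (ht : AffineIndependent ℝ ((↑) : t → V))
    {w w' : V → ℝ} (h1 : ∑ y ∈ t, w y = ∑ y ∈ t, w' y)
    (h2 : ∑ y ∈ t, w y • y = ∑ y ∈ t, w' y • y) : ∀ y ∈ t, w y = w' y := by
  intro y hy
  have := affineIndependent_iff.1 ht Finset.univ (fun y => w y - w' y)
    (by
      rw [Finset.sum_coe_sort t fun y => w y - w' y, Finset.sum_sub_distrib, h1, sub_self])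
    (by
      rw [Finset.sum_coe_sort t fun y => (w y - w' y) • y]
      simp_rw [sub_smul]
      rw [Finset.sum_sub_distrib, h2, sub_self]) ⟨y, hy⟩ (Finset.mem_univ _)
  exact sub_eq_zero.1 this

theorem IsBarycentric.unique {t : Finset V} (ht : AffineIndependent ℝ ((↑) : t → V))
    {w w' : V → ℝ} {x : V} (h : IsBarycentric t w x) (h' : IsBarycentric t w' x) : w = w' := by
  ext y
  by_cases hy : y ∈ t
  · exact ht.eq_of_sum_eq (h.sum_eq.trans h'.sum_eq.symm) (h.sum_smul_eq.trans h'.sum_smul_eq.symm) y hy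
  · rw [h.eq_zero y hy, h'.eq_zero y hy]

/-- A point of the underlying space of a simplicial complex has just one system of barycentric
coordinates. -/
theorem Geometry.SimplicialComplex.isBarycentric_unique (K : Geometry.SimplicialComplex ℝ V)
    {t t' : Finset V} (ht : t ∈ K.faces) (ht' : t' ∈ K.faces) {w w' : V → ℝ} {x : V}
    (h : IsBarycentric t w x) (h' : IsBarycentric t' w' x) : w = w' := by
  classical
  -- Coordinates with respect to the common face `t ∩ t'` are coordinates with respect to both `t`
  -- and `t'`.
  have hx := K.inter_subset_convexHull ht ht' ⟨h.mem_convexHull, h'.mem_convexHull⟩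
  rw [← Finset.coe_inter] at hx
  obtain ⟨w'', hw⟩ := mem_convexHull_iff_exists_isBarycentric.1 hx
  exact (h.unique (K.indep ht) (hw.mono Finset.inter_subset_left)).trans
    (h'.unique (K.indep ht') (hw.mono Finset.inter_subset_right)).symm

/-- If the coordinates of `x` are positive on `s`, every face that contains `x` contains `s`. -/
theorem Geometry.SimplicialComplex.subset_of_mem_convexHull (K : Geometry.SimplicialComplex ℝ V)
    {s t : Finset V} (hs : s ∈ K.faces) (ht : t ∈ K.faces) {w : V → ℝ} {x : V}
    (h : IsBarycentric s w x) (hpos : ∀ y ∈ s, 0 < w y) (hx : x ∈ convexHull ℝ (t : Set V)) :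
    s ⊆ t := by
  obtain ⟨w', hw'⟩ := mem_convexHull_iff_exists_isBarycentric.1 hx
  intro y hy
  by_contra hyt
  have := hpos y hy
  rw [K.isBarycentric_unique hs ht h hw', hw'.eq_zero y hyt] at this
  exact this.false

/-! ### Charts on simplices -/

variable [TopologicalSpace V] [ContinuousAdd V] [ContinuousSMul ℝ V]

/-- A simplex contains an injective image of an open set of its dimension. -/
theorem IsBarycentric.exists_chart {t : Finset V} (ht : AffineIndependent ℝ ((↑) : t → V))
    {w : V → ℝ} {x : V} (hw : IsBarycentric t w x) (hpos : ∀ y ∈ t, 0 < w y) :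
    ∃ (U : Set (sumZero t)) (g : sumZero t → V), IsOpen U ∧ 0 ∈ U ∧ Continuous g ∧ InjOn g U ∧
      MapsTo g U (convexHull ℝ (t : Set V)) ∧ g 0 = x := by
  -- The chart displaces the barycentric coordinates of `x` by a vector of sum zero, small enough to
  -- keep them positive.
  set W : sumZero t → V → ℝ := fun v y => w y + zeroExtend t v y with hW
  set g : sumZero t → V := fun v => ∑ y ∈ t, W v y • y with hg
  have hbar : ∀ v : sumZero t, (∀ y ∈ t, 0 < W v y) → IsBarycentric t (W v) (g v) := fun v hv =>
    { eq_zero := fun y hy => by simp only [hW]; rw [hw.eq_zero y hy, zeroExtend_of_notMem _ hy, add_zero]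
      nonneg := fun y => by
        by_cases hy : y ∈ t
        · exact (hv y hy).le
        · simp only [hW]; rw [hw.eq_zero y hy, zeroExtend_of_notMem _ hy, add_zero]
      sum_eq := by
        simp only [hW]; rw [Finset.sum_add_distrib, hw.sum_eq, sum_zeroExtend v.2, add_zero]
      sum_smul_eq := rfl }
  refine ⟨⋂ y ∈ t, {v | 0 < W v y}, g, ?_, ?_, ?_, ?_, ?_, ?_⟩
  · refine isOpen_biInter_finset fun y _ => isOpen_lt continuous_const ?_
    simp only [hW]; fun_prop
  · simp only [mem_iInter]
    intro y hy
    simpa [hW, zeroExtend] using hpos y hy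
  · simp only [hg, hW]; fun_prop
  · intro v hv v' hv' h
    simp only [mem_iInter] at hv hv'
    have h1 := hbar v hv
    rw [h] at h1
    have h2 := h1.unique ht (hbar v' hv')
    refine Subtype.ext (zeroExtend_injective t (funext fun y => ?_))
    exact add_left_cancel (congrFun h2 y)
  · intro v hv
    simp only [mem_iInter] at hv
    exact (hbar v hv).mem_convexHull
  · simp only [hg, hW]
    rw [← hw.sum_smul_eq]
    simp [zeroExtend]

/-- Two simplices with a common facet contain an injective image of an open set of their dimension
around each point in the relative interior of the facet. -/
theorem IsBarycentric.exists_chart_of_two_simplices [DecidableEq V]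
    (K : Geometry.SimplicialComplex ℝ V) {s : Finset V} {a b : V} (ha : a ∉ s) (hb : b ∉ s)
    (hab : a ≠ b) (hsa : insert a s ∈ K.faces) (hsb : insert b s ∈ K.faces)
    {w : V → ℝ} {x : V} (hw : IsBarycentric s w x) (hpos : ∀ y ∈ s, 0 < w y) :
    ∃ (U : Set (sumZero (insert a s))) (g : sumZero (insert a s) → V),
      IsOpen U ∧ 0 ∈ U ∧ Continuous g ∧ InjOn g U ∧ g 0 = x ∧
      ∀ v ∈ U, g v ∈ convexHull ℝ ((insert a s : Finset V) : Set V) ∪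
        convexHull ℝ ((insert b s : Finset V) : Set V) := by
  set e : sumZero (insert a s) → V → ℝ := fun v => zeroExtend (insert a s) v with he
  have hec : ∀ y, Continuous fun v => e v y := fun y => continuous_zeroExtend _ y
  set N : sumZero (insert a s) → ℝ := fun v => max (-e v a) 0 with hN
  have hNc : Continuous N := ((hec a).neg).max continuous_const
  -- The coordinate `e v a` is a signed height over the facet: its positive part is the weight of
  -- `a`, its negative part `N v` the weight of `b`. On the `b` side the weights `w y + e v y` on
  -- `s` sum to `1 + N v` instead of `1 - N v`, hence the correction by `2 * N v`, distributed
  -- proportionally to `w`.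
  set W : sumZero (insert a s) → V → ℝ := fun v y =>
    if y = a then max (e v a) 0 else if y = b then N v else
      w y + e v y - 2 * N v * w y with hW
  have hWa : ∀ v, W v a = max (e v a) 0 := fun v => by simp [hW]
  have hWb : ∀ v, W v b = N v := fun v => by simp [hW, hab.symm]
  have hWs : ∀ v, ∀ y ≠ a, y ≠ b → W v y = w y + e v y - 2 * N v * w y := fun v y h1 h2 => by
    simp [hW, h1, h2]
  have hW0 : ∀ v, ∀ y ≠ a, y ≠ b → y ∉ s → W v y = 0 := fun v y h1 h2 h3 => by
    rw [hWs v y h1 h2, hw.eq_zero y h3]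
    simp [he, zeroExtend, h1, h3]
  have hWc : ∀ y, Continuous fun v => W v y := by
    intro y
    have := hec y
    have := hec a
    by_cases h1 : y = a
    · subst h1; simp only [hWa]; fun_prop
    by_cases h2 : y = b
    · subst h2; simpa only [hWb]
    simp only [hWs _ y h1 h2]; fun_prop
  have hsum : ∀ v, e v a + ∑ y ∈ s, e v y = 0 := fun v => by
    rw [← Finset.sum_insert ha]; exact sum_zeroExtend v.2
  have hWsum : ∀ v, ∑ y ∈ s, W v y = 1 - e v a - 2 * N v := fun v => by
    rw [Finset.sum_congr rfl fun y hy => hWs v y (fun h => ha (h ▸ hy)) fun h => hb (h ▸ hy),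
      Finset.sum_sub_distrib, Finset.sum_add_distrib, ← Finset.mul_sum, hw.sum_eq]
    linarith [hsum v]
  set g : sumZero (insert a s) → V := fun v => ∑ y ∈ insert b (insert a s), W v y • y with hg
  have hgeq : ∀ v, g v = W v b • b + (W v a • a + ∑ y ∈ s, W v y • y) := fun v => by
    simp only [hg]
    rw [Finset.sum_insert (by simp [hb, hab.symm]), Finset.sum_insert ha]
  have hnonneg : ∀ v, (∀ y ∈ s, 0 < W v y) → ∀ y, 0 ≤ W v y := fun v hv y => by
    by_cases h1 : y = a
    · subst h1; rw [hWa]; exact le_max_right _ _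
    by_cases h2 : y = b
    · subst h2; rw [hWb]; exact le_max_right _ _
    by_cases h3 : y ∈ s
    · exact (hv y h3).le
    · rw [hW0 v y h1 h2 h3]
  have hbar : ∀ v, (∀ y ∈ s, 0 < W v y) →
      ∃ t ∈ K.faces, (t = insert a s ∨ t = insert b s) ∧ IsBarycentric t (W v) (g v) := by
    intro v hv
    rcases le_total 0 (e v a) with h | h
    · have hNv : N v = 0 := max_eq_right (neg_nonpos.2 h)
      have hb0 : W v b = 0 := by rw [hWb, hNv]
      refine ⟨_, hsa, Or.inl rfl, fun y hy => ?_, hnonneg v hv, ?_, ?_⟩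
      · simp only [Finset.mem_insert, not_or] at hy
        by_cases h2 : y = b
        · rw [h2, hb0]
        · exact hW0 v y hy.1 h2 hy.2
      · rw [Finset.sum_insert ha, hWsum, hWa, max_eq_left h, hNv]; ring
      · rw [hgeq, hb0, Finset.sum_insert ha]; simp
    · have hNv : N v = -e v a := max_eq_left (neg_nonneg.2 h)
      have ha0 : W v a = 0 := by rw [hWa, max_eq_right h]
      refine ⟨_, hsb, Or.inr rfl, fun y hy => ?_, hnonneg v hv, ?_, ?_⟩
      · simp only [Finset.mem_insert, not_or] at hy
        by_cases h2 : y = a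
        · rw [h2, ha0]
        · exact hW0 v y h2 hy.1 hy.2
      · rw [Finset.sum_insert hb, hWsum, hWb, hNv]; ring
      · rw [hgeq, ha0, Finset.sum_insert hb]; simp
  have he0 : ∀ y, e 0 y = 0 := fun y => by simp [he, zeroExtend]
  have hN0 : N 0 = 0 := by simp [hN, he0]
  refine ⟨⋂ y ∈ s, {v | 0 < W v y}, g, ?_, ?_, ?_, ?_, ?_, ?_⟩
  · exact isOpen_biInter_finset fun y _ => isOpen_lt continuous_const (hWc y)
  · simp only [mem_iInter]
    intro y hy
    rw [mem_ofPred_eq, hWs 0 y (fun h => ha (h ▸ hy)) fun h => hb (h ▸ hy), he0, hN0]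
    simpa using hpos y hy
  · exact continuous_finsetSum _ fun y _ => (hWc y).smul continuous_const
  · intro v hv v' hv' h
    simp only [mem_iInter] at hv hv'
    obtain ⟨t, ht, -, h1⟩ := hbar v hv
    obtain ⟨t', ht', -, h2⟩ := hbar v' hv'
    rw [h] at h1
    have h3 := K.isBarycentric_unique ht ht' h1 h2
    -- The height, and with it the whole vector `v`, can be recovered from the weights.
    have hea : ∀ v, e v a = W v a - W v b := fun v => by
      rw [hWa, hWb, hN]
      rcases le_total 0 (e v a) with h | h <;> simp [h]
    have h4 : e v a = e v' a := by rw [hea, hea, h3]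
    have h5 : N v = N v' := by simp only [hN, h4]
    refine Subtype.ext (zeroExtend_injective _ (funext fun y => ?_))
    change e v y = e v' y
    by_cases hya : y = a
    · rw [hya, h4]
    by_cases hys : y ∈ s
    · have h6 := congrFun h3 y
      have hyb : y ≠ b := fun h => hb (h ▸ hys)
      rw [hWs v y hya hyb, hWs v' y hya hyb, h5] at h6
      linarith
    · simp [he, zeroExtend, hya, hys]
  · rw [hgeq, hWb, hWa, hN0, he0, ← hw.sum_smul_eq]
    simp only [max_self, zero_smul, zero_add]
    refine Finset.sum_congr rfl fun y hy => ?_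
    rw [hWs 0 y (fun h => ha (h ▸ hy)) fun h => hb (h ▸ hy), he0, hN0]
    simp
  · intro v hv
    simp only [mem_iInter] at hv
    obtain ⟨t, -, rfl | rfl, h⟩ := hbar v hv
    exacts [Or.inl h.mem_convexHull, Or.inr h.mem_convexHull]

end Barycentric
/-! ### Local structure of triangulated balls -/

section BallTriangulation

open Set Filter Topology Metric

variable {d : ℕ}

/-- A homeomorphism from the unit ball, and its inverse, as maps of the ambient spaces. -/
theorem exists_chart_of_homeomorph {i : ℕ} {X : Set (EuclideanSpace ℝ (Fin d))}
    (h : closedBall (0 : EuclideanSpace ℝ (Fin i)) 1 ≃ₜ X) :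
    ∃ (φ : EuclideanSpace ℝ (Fin d) → EuclideanSpace ℝ (Fin i))
      (ψ : EuclideanSpace ℝ (Fin i) → EuclideanSpace ℝ (Fin d)),
      ContinuousOn φ X ∧ ContinuousOn ψ (closedBall 0 1) ∧ MapsTo φ X (closedBall 0 1) ∧
      MapsTo ψ (closedBall 0 1) X ∧ LeftInvOn ψ φ X ∧ LeftInvOn φ ψ (closedBall 0 1) ∧
      ∀ y, (h y : EuclideanSpace ℝ (Fin d)) = ψ y := by
  classical
  refine ⟨fun x => if hx : x ∈ X then h.symm ⟨x, hx⟩ else 0,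
    fun y => if hy : y ∈ closedBall (0 : EuclideanSpace ℝ (Fin i)) 1 then h ⟨y, hy⟩ else 0,
    ?_, ?_, ?_, ?_, ?_, ?_, ?_⟩
  · rw [continuousOn_iff_continuous_domRestrict]
    refine (continuous_subtype_val.comp h.symm.continuous).congr fun x => ?_
    simp [domRestrict]
  · rw [continuousOn_iff_continuous_domRestrict]
    refine (continuous_subtype_val.comp h.continuous).congr fun x => ?_
    have := x.2
    simp [domRestrict, -mem_closedBall]
  · intro x hx
    simp only [hx, dite_true]
    exact (h.symm ⟨x, hx⟩).2
  · intro y hy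
    simp only [hy, dite_true]
    exact (h ⟨y, hy⟩).2
  · intro x hx
    simp [hx, -mem_closedBall]
  · intro y hy
    simp [hy, -mem_closedBall]
  · rintro ⟨y, hy⟩
    simp only [hy, dite_true]

/-- A subset of a ball that is an injective image of an open set of the same dimension does not
meet the boundary of the ball, and corresponds to an open set of the model ball. -/
theorem notMem_ballBoundary_of_injOn {i : ℕ} {X : Set (EuclideanSpace ℝ (Fin d))}
    {D : Type*} [NormedAddCommGroup D] [NormedSpace ℝ D] [FiniteDimensional ℝ D]
    (hD : Module.finrank ℝ D = i) {U : Set D} (hU : IsOpen U)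
    {g : D → EuclideanSpace ℝ (Fin d)} (hg : ContinuousOn g U) (hinj : InjOn g U)
    (hm : MapsTo g U X) {v : D} (hv : v ∈ U) : g v ∉ ballBoundary i X := by
  rintro ⟨h, y, hy, hyv⟩
  obtain ⟨φ, ψ, hφ, -, hφm, -, hψφ, hφψ, hh⟩ := exists_chart_of_homeomorph h
  have hopen := (hφ.comp hg hm).isOpen_image_of_injOn_of_finrank_eq (by simp [hD]) hU
    (hψφ.injOn.comp hinj hm)
  have hsub : (φ ∘ g) '' U ⊆ closedBall 0 1 := by
    rintro _ ⟨w, hw, rfl⟩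
    exact hφm (hm hw)
  have hyU : (y : EuclideanSpace ℝ (Fin i)) ∈ (φ ∘ g) '' U := by
    refine ⟨v, hv, ?_⟩
    rw [Function.comp_apply, ← hyv, hh, hφψ y.2]
  have h0 : (y : EuclideanSpace ℝ (Fin i)) ≠ 0 := fun h0 => by simp [h0] at hy
  have := hopen.subset_interior_iff.2 hsub hyU
  -- By invariance of domain the image in the model ball is open, hence contains no point of norm
  -- `1`.
  rw [interior_closedBall _ one_ne_zero, mem_ball_zero_iff, hy] at this
  exact this.false

variable {K : Geometry.SimplicialComplex ℝ (EuclideanSpace ℝ (Fin d))} {i : ℕ}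

theorem IsBallTriangulation.card_le (hK : IsBallTriangulation i K)
    {t : Finset (EuclideanSpace ℝ (Fin d))} (ht : t ∈ K.faces) : t.card ≤ i + 1 := by
  obtain ⟨-, ⟨h⟩⟩ := hK
  obtain ⟨φ, ψ, hφ, -, hφm, -, hψφ, -, -⟩ := exists_chart_of_homeomorph h
  have hne := K.nonempty_of_mem_faces ht
  obtain ⟨w, x, hw, hpos⟩ := exists_isBarycentric_pos hne
  obtain ⟨U, g, hU, h0, hg, hinj, hm, -⟩ := hw.exists_chart (K.indep ht) hpos
  have hm' : MapsTo g U K.space := hm.mono_right (K.convexHull_subset_space ht)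
  have h1 := (hφ.comp hg.continuousOn hm').finrank_le_of_injOn hU ⟨0, h0⟩
    (hψφ.injOn.comp hinj hm')
  have := finrank_sumZero_add_one hne
  rw [finrank_euclideanSpace_fin] at h1
  omega

/-- A simplex of full dimension does not lie in the boundary. -/
theorem notMem_boundaryFaces_of_card_eq {s : Finset (EuclideanSpace ℝ (Fin d))}
    (hs : s.card = i + 1) : s ∉ boundaryFaces i K := by
  rintro ⟨hsK, hsb⟩
  have hne := K.nonempty_of_mem_faces hsK
  obtain ⟨w, x, hw, hpos⟩ := exists_isBarycentric_pos hne
  obtain ⟨U, g, hU, h0, hg, hinj, hm, -⟩ := hw.exists_chart (K.indep hsK) hpos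
  refine notMem_ballBoundary_of_injOn (by have := finrank_sumZero_add_one hne; omega) hU
    hg.continuousOn hinj (hm.mono_right (K.convexHull_subset_space hsK)) h0 (hsb (hm h0))

open Classical in
theorem notMem_boundaryFaces_of_two_simplices {s : Finset (EuclideanSpace ℝ (Fin d))}
    (hs : s.card = i + 1) {a b : EuclideanSpace ℝ (Fin d)} (ha : a ∉ s) (hb : b ∉ s)
    (hab : a ≠ b) (hsa : insert a s ∈ K.faces) (hsb : insert b s ∈ K.faces) :
    s ∉ boundaryFaces (i + 1) K := by
  rintro ⟨hsK, hsbd⟩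
  obtain ⟨w, x, hw, hpos⟩ := exists_isBarycentric_pos (K.nonempty_of_mem_faces hsK)
  obtain ⟨U, g, hU, h0, hg, hinj, hgx, hm⟩ :=
    hw.exists_chart_of_two_simplices K ha hb hab hsa hsb hpos
  refine notMem_ballBoundary_of_injOn (i := i + 1) (X := K.space) ?_ hU
    hg.continuousOn hinj (fun v hv => ?_) h0 (hgx ▸ hsbd hw.mem_convexHull)
  · have := finrank_sumZero_add_one (K.nonempty_of_mem_faces hsa)
    rw [Finset.card_insert_of_notMem ha] at this
    omega
  · exact (hm v hv).elim (fun h => K.convexHull_subset_space hsa h)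
      fun h => K.convexHull_subset_space hsb h

open Classical in
-- By invariance of domain, two simplices sharing the facet `s` already fill a neighbourhood in the
-- complex of a relative interior point of `s`. A short move from there towards a third vertex `c`
-- would stay in that neighbourhood, yet it has a positive `c`-coordinate and so leaves both
-- simplices.
theorem IsBallTriangulation.not_three_simplices (hK : IsBallTriangulation (i + 1) K)
    {s : Finset (EuclideanSpace ℝ (Fin d))} (hs : s.card = i + 1) (hsK : s ∈ K.faces)
    {a b c : EuclideanSpace ℝ (Fin d)} (ha : a ∉ s) (hb : b ∉ s) (hc : c ∉ s)
    (hab : a ≠ b) (hac : a ≠ c) (hbc : b ≠ c) (hsa : insert a s ∈ K.faces)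
    (hsb : insert b s ∈ K.faces) : insert c s ∉ K.faces := by
  intro hsc
  obtain ⟨w, x, hw, hpos⟩ := exists_isBarycentric_pos (K.nonempty_of_mem_faces hsK)
  obtain ⟨U, g, hU, h0, hg, hinj, hgx, hm⟩ :=
    hw.exists_chart_of_two_simplices K ha hb hab hsa hsb hpos
  obtain ⟨-, ⟨h⟩⟩ := hK
  obtain ⟨φ, ψ, hφ, -, hφm, -, hψφ, -, -⟩ := exists_chart_of_homeomorph h
  have hgm : MapsTo g U K.space := fun v hv =>
    (hm v hv).elim (fun h => K.convexHull_subset_space hsa h)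
      fun h => K.convexHull_subset_space hsb h
  have hopen : IsOpen ((φ ∘ g) '' U) := by
    refine (hφ.comp hg.continuousOn hgm).isOpen_image_of_injOn_of_finrank_eq ?_ hU
      (hψφ.injOn.comp hinj hgm)
    have := finrank_sumZero_add_one (K.nonempty_of_mem_faces hsa)
    rw [Finset.card_insert_of_notMem ha] at this
    rw [finrank_euclideanSpace_fin]
    omega
  set p : ℝ → EuclideanSpace ℝ (Fin d) := fun r => (1 - r) • x + r • c with hp
  have hbar : ∀ r ∈ Icc (0 : ℝ) 1, IsBarycentric (insert c s)
      (fun y => (1 - r) * w y + r * if y = c then 1 else 0) (p r) := fun r hr => by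
    have hcv : IsBarycentric (insert c s) (fun y => if y = c then (1 : ℝ) else 0) c :=
      (isBarycentric_vertex (a := c)).mono
        (Finset.singleton_subset_iff.2 (Finset.mem_insert_self c s))
    exact (hw.mono (Finset.subset_insert c s)).combo hcv (by linarith [hr.2]) hr.1 (by ring)
  have hpX : MapsTo p (Icc 0 1) K.space := fun r hr =>
    K.convexHull_subset_space hsc (hbar r hr).mem_convexHull
  have hcont : ContinuousOn (φ ∘ p) (Icc 0 1) := hφ.comp (by fun_prop) hpX
  have hmem : (φ ∘ p) 0 ∈ (φ ∘ g) '' U := ⟨0, h0, by simp [hgx, hp]⟩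
  have hev : ∀ᶠ r in 𝓝[>] (0 : ℝ), r ∈ Ioc (0 : ℝ) 1 ∧ (φ ∘ p) r ∈ (φ ∘ g) '' U := by
    have h1 : ∀ᶠ r in 𝓝[Icc 0 1] (0 : ℝ), (φ ∘ p) r ∈ (φ ∘ g) '' U :=
      hcont 0 (by simp) (hopen.mem_nhds hmem)
    have h2 : Ioc (0 : ℝ) 1 ∈ 𝓝[>] (0 : ℝ) := Ioc_mem_nhdsGT one_pos
    have h3 : 𝓝[>] (0 : ℝ) ≤ 𝓝[Icc 0 1] (0 : ℝ) := by
      rw [← nhdsWithin_Ioc_eq_nhdsGT (one_pos (α := ℝ))]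
      exact nhdsWithin_mono _ Ioc_subset_Icc_self
    exact (Filter.Eventually.and h2 (h3 h1))
  obtain ⟨r, hr, v, hv, hvr⟩ := hev.exists
  have hrI : r ∈ Icc (0 : ℝ) 1 := Ioc_subset_Icc_self hr
  have heq : g v = p r := hψφ.injOn (hgm hv) (hpX hrI) hvr
  have hcpos : 0 < (fun y => (1 - r) * w y + r * if y = c then 1 else 0) c := by
    simpa [hw.eq_zero c hc] using hr.1
  have key : ∀ e, e ≠ c → insert e s ∈ K.faces →
      g v ∉ convexHull ℝ ((insert e s : Finset _) : Set (EuclideanSpace ℝ (Fin d))) := by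
    intro e hec he hge
    obtain ⟨w', hw'⟩ := mem_convexHull_iff_exists_isBarycentric.1 hge
    rw [heq] at hw'
    rw [K.isBarycentric_unique hsc he (hbar r hrI) hw',
      hw'.eq_zero c (by simp [hc, hec.symm])] at hcpos
    exact hcpos.false
  exact (hm v hv).elim (key a hac hsa) (key b hbc hsb)

/-- If all faces containing `s` lie in `t`, then near a point in the relative interior of `s` the
complex is covered by the simplex `t`. -/
theorem IsBarycentric.eventually_mem_convexHull (hK : K.faces.Finite)
    {s t : Finset (EuclideanSpace ℝ (Fin d))} (hs : s ∈ K.faces)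
    (hst : ∀ r ∈ K.faces, s ⊆ r → r ⊆ t) {w : EuclideanSpace ℝ (Fin d) → ℝ}
    {x : EuclideanSpace ℝ (Fin d)} (hw : IsBarycentric s w x) (hpos : ∀ y ∈ s, 0 < w y) :
    ∀ᶠ y in 𝓝[K.space] x, y ∈ convexHull ℝ (t : Set (EuclideanSpace ℝ (Fin d))) := by
  -- The finitely many simplices not containing `s` form a closed set that misses `x`.
  have hclosed : IsClosed (⋃ r ∈ {r ∈ K.faces | ¬ s ⊆ r},
      convexHull ℝ (r : Set (EuclideanSpace ℝ (Fin d)))) :=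
    (hK.subset (sep_subset _ _)).isClosed_biUnion fun r _ =>
      (r.finite_toSet.isCompact_convexHull (𝕜 := ℝ)).isClosed
  have hx : x ∉ ⋃ r ∈ {r ∈ K.faces | ¬ s ⊆ r},
      convexHull ℝ (r : Set (EuclideanSpace ℝ (Fin d))) := by
    simp only [mem_iUnion, not_exists]
    rintro r ⟨hr, hsr⟩ hxr
    exact hsr (K.subset_of_mem_convexHull hs hr hw hpos hxr)
  filter_upwards [nhdsWithin_le_nhds (hclosed.isOpen_compl.mem_nhds hx), self_mem_nhdsWithin]
    with y hy hyK
  obtain ⟨r, hr, hyr⟩ := K.mem_space_iff.1 hyK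
  by_cases hsr : s ⊆ r
  · exact convexHull_mono (by exact_mod_cast hst r hr hsr) hyr
  · exact absurd (mem_biUnion (show r ∈ {r ∈ K.faces | ¬ s ⊆ r} from ⟨hr, hsr⟩) hyr) hy

/-- The injection of an open set into a simplex, followed by the projection to its direction. -/
theorem exists_map_to_vectorSpan {D : Type*} [TopologicalSpace D] {U : Set D}
    {t : Finset (EuclideanSpace ℝ (Fin d))} {ψ : D → EuclideanSpace ℝ (Fin d)}
    (hψ : ContinuousOn ψ U) (hinj : InjOn ψ U)
    (hm : MapsTo ψ U (convexHull ℝ (t : Set (EuclideanSpace ℝ (Fin d)))))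
    {x : EuclideanSpace ℝ (Fin d)}
    (hx : x ∈ convexHull ℝ (t : Set (EuclideanSpace ℝ (Fin d)))) :
    ∃ f : D → vectorSpan ℝ (t : Set (EuclideanSpace ℝ (Fin d))), ContinuousOn f U ∧ InjOn f U ∧
      ∀ z ∈ U, (f z : EuclideanSpace ℝ (Fin d)) = ψ z - x := by
  set W := vectorSpan ℝ (t : Set (EuclideanSpace ℝ (Fin d))) with hW
  have hmem : ∀ z ∈ U, ψ z - x ∈ W := fun z hz => by
    have := AffineSubspace.vsub_mem_direction (convexHull_subset_affineSpan _ (hm hz))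
      (convexHull_subset_affineSpan _ hx)
    rwa [direction_affineSpan] at this
  have hf : ∀ z ∈ U, (W.orthogonalProjectionOnto (ψ z - x) : EuclideanSpace ℝ (Fin d)) = ψ z - x :=
    fun z hz => Submodule.starProjection_eq_self_iff.2 (hmem z hz)
  refine ⟨fun z => W.orthogonalProjectionOnto (ψ z - x), ?_, fun z hz z' hz' h => ?_, hf⟩
  · exact W.orthogonalProjectionOnto.continuous.comp_continuousOn (hψ.sub continuousOn_const)
  · refine hinj hz hz' (sub_left_injective (b := x) ?_)
    change ψ z - x = ψ z' - x
    rw [← hf z hz, ← hf z' hz']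
    exact congrArg Subtype.val h

theorem finrank_vectorSpan_add_one {t : Finset (EuclideanSpace ℝ (Fin d))} (ht : t ∈ K.faces) :
    Module.finrank ℝ (vectorSpan ℝ (t : Set (EuclideanSpace ℝ (Fin d)))) + 1 = t.card := by
  have hc := Finset.card_pos.2 (K.nonempty_of_mem_faces ht)
  have := (K.indep ht).finrank_vectorSpan (n := t.card - 1) (by simp; omega)
  rw [Subtype.range_coe_subtype] at this
  have e : {x | x ∈ t} = (t : Set (EuclideanSpace ℝ (Fin d))) := rfl
  rw [e] at this
  omega

/-- If `s` were maximal, the complex near a relative interior point of `s` would lie in an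
`i`-dimensional simplex while containing an injective image of an open set of dimension `i + 1`. -/
theorem IsBallTriangulation.exists_ssuperset (hK : IsBallTriangulation (i + 1) K)
    {s : Finset (EuclideanSpace ℝ (Fin d))} (hs : s.card = i + 1) (hsK : s ∈ K.faces) :
    ∃ t ∈ K.faces, s ⊂ t := by
  by_contra! hno
  have hst : ∀ r ∈ K.faces, s ⊆ r → r ⊆ s := fun r hr hsr => by
    by_contra h
    exact hno r hr ⟨hsr, h⟩
  obtain ⟨w, x, hw, hpos⟩ := exists_isBarycentric_pos (K.nonempty_of_mem_faces hsK)
  have hev := hw.eventually_mem_convexHull hK.1 hsK hst hpos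
  obtain ⟨-, ⟨h⟩⟩ := hK
  obtain ⟨φ, ψ, hφ, hψ, hφm, hψm, hψφ, hφψ, -⟩ := exists_chart_of_homeomorph h
  have hxK : x ∈ K.space := K.convexHull_subset_space hsK hw.mem_convexHull
  have hu := hφm hxK
  have hψt : Tendsto ψ (𝓝[closedBall 0 1] φ x) (𝓝[K.space] x) := by
    have := (hψ (φ x) hu).tendsto_nhdsWithin hψm
    rwa [hψφ hxK] at this
  obtain ⟨O, hO, hOu, hOB⟩ := mem_nhdsWithin.1 (hψt hev)
  -- The point `φ x` may lie on the sphere, so an open set of the model is obtained by intersecting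
  -- with the dense open ball.
  have hne : (O ∩ ball 0 1).Nonempty := by
    refine mem_closure_iff.1 ?_ O hO hOu
    rwa [closure_ball _ one_ne_zero]
  have hsub : O ∩ ball (0 : EuclideanSpace ℝ (Fin (i + 1))) 1 ⊆ closedBall 0 1 :=
    inter_subset_right.trans ball_subset_closedBall
  obtain ⟨f, hfc, hfi, -⟩ := exists_map_to_vectorSpan (U := O ∩ ball 0 1) (hψ.mono hsub)
    (hφψ.injOn.mono hsub) (fun z hz => hOB ⟨hz.1, hsub hz⟩) hw.mem_convexHull
  have h1 := hfc.finrank_le_of_injOn (hO.inter isOpen_ball) hne hfi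
  have h2 := finrank_vectorSpan_add_one hsK
  rw [finrank_euclideanSpace_fin] at h1
  omega

open Classical in
-- If a relative interior point `x` of `s` corresponded to an interior point of the ball, the only
-- simplex at `s` would contain a neighbourhood of `x` in its affine span; but moving from `x` away
-- from `a` makes the `a`-coordinate negative. The remaining points of `s` are limits of relative
-- interior ones.
theorem IsBallTriangulation.mem_boundaryFaces (hK : IsBallTriangulation (i + 1) K)
    {s : Finset (EuclideanSpace ℝ (Fin d))} (hs : s.card = i + 1) (hsK : s ∈ K.faces)
    {a : EuclideanSpace ℝ (Fin d)} (ha : a ∉ s) (hsa : insert a s ∈ K.faces)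
    (hst : ∀ r ∈ K.faces, s ⊆ r → r ⊆ insert a s) : s ∈ boundaryFaces (i + 1) K := by
  have hKf := hK.1
  obtain ⟨-, ⟨h⟩⟩ := hK
  obtain ⟨φ, ψ, hφ, hψ, hφm, hψm, hψφ, hφψ, hh⟩ := exists_chart_of_homeomorph h
  have hint : ∀ (w : EuclideanSpace ℝ (Fin d) → ℝ) (x : EuclideanSpace ℝ (Fin d)),
      IsBarycentric s w x → (∀ y ∈ s, 0 < w y) → ‖φ x‖ = 1 := by
    intro w x hw hpos
    have hev := hw.eventually_mem_convexHull hKf hsK hst hpos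
    have hxK : x ∈ K.space := K.convexHull_subset_space hsK hw.mem_convexHull
    have hu := hφm hxK
    refine le_antisymm (by simpa using hu) (not_lt.1 fun hlt => ?_)
    have hψt : Tendsto ψ (𝓝[closedBall 0 1] φ x) (𝓝[K.space] x) := by
      have := (hψ (φ x) hu).tendsto_nhdsWithin hψm
      rwa [hψφ hxK] at this
    rw [nhdsWithin_eq_nhds.2 (mem_of_superset (isOpen_ball.mem_nhds (by simpa using hlt))
      ball_subset_closedBall)] at hψt
    obtain ⟨O, hOB, hO, hOu⟩ := _root_.mem_nhds_iff.1 (hψt hev)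
    have hsub : O ∩ ball (0 : EuclideanSpace ℝ (Fin (i + 1))) 1 ⊆ closedBall 0 1 :=
      inter_subset_right.trans ball_subset_closedBall
    obtain ⟨f, hfc, hfi, hf⟩ := exists_map_to_vectorSpan (U := O ∩ ball 0 1) (hψ.mono hsub)
      (hφψ.injOn.mono hsub) (fun z hz => hOB hz.1)
      (hw.mono (Finset.subset_insert a s)).mem_convexHull
    have hopen := hfc.isOpen_image_of_injOn_of_finrank_eq (by
      have h2 := finrank_vectorSpan_add_one hsa
      rw [Finset.card_insert_of_notMem ha] at h2
      rw [finrank_euclideanSpace_fin]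
      omega) (hO.inter isOpen_ball) hfi
    have hax : x - a ∈ vectorSpan ℝ ((insert a s : Finset _) : Set (EuclideanSpace ℝ (Fin d))) := by
      have := AffineSubspace.vsub_mem_direction
        (convexHull_subset_affineSpan _ (hw.mono (Finset.subset_insert a s)).mem_convexHull)
        (subset_affineSpan ℝ _ (show a ∈ ((insert a s : Finset _) : Set _) by simp))
      rwa [direction_affineSpan] at this
    -- Zero is written as a multiple of `x - a` so that openness applies along the line `r ↦ r • (x
    -- - a)`.
    have hmem : (0 : ℝ) • (⟨x - a, hax⟩ : vectorSpan ℝ _) ∈ f '' (O ∩ ball 0 1) := by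
      have hzU : φ x ∈ O ∩ ball 0 1 := ⟨hOu, by simpa using hlt⟩
      refine ⟨φ x, hzU, Subtype.ext ?_⟩
      rw [hf _ hzU, hψφ hxK]
      simp
    have hev2 : ∀ᶠ r in 𝓝 (0 : ℝ), r • (⟨x - a, hax⟩ : vectorSpan ℝ _) ∈ f '' (O ∩ ball 0 1) :=
      (show Continuous fun r : ℝ => r • (⟨x - a, hax⟩ : vectorSpan ℝ _) by fun_prop).continuousAt
        (hopen.mem_nhds hmem)
    obtain ⟨r, ⟨z, hz, hzr⟩, hr⟩ := ((hev2.filter_mono nhdsWithin_le_nhds).and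
      (self_mem_nhdsWithin (s := Ioi (0 : ℝ)))).exists
    have hr0 : 0 < r := hr
    have hψz : ψ z = (1 + r) • x - r • a := by
      have := congrArg Subtype.val hzr
      rw [hf z hz] at this
      rw [sub_eq_iff_eq_add.1 this]
      change r • (x - a) + x = _
      module
    obtain ⟨w', hw'⟩ := mem_convexHull_iff_exists_isBarycentric.1 (hOB hz.1)
    rw [hψz] at hw'
    have hne : ∀ y ∈ s, y ≠ a := fun y hy h => ha (h ▸ hy)
    have heq := (K.indep hsa).eq_of_sum_eq (w := w')
      (w' := fun y => (1 + r) * w y - r * if y = a then 1 else 0)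
      (by
        rw [hw'.sum_eq, Finset.sum_sub_distrib, ← Finset.mul_sum,
          (hw.mono (Finset.subset_insert a s)).sum_eq]
        simp)
      (by
        rw [hw'.sum_smul_eq]
        simp_rw [sub_smul, mul_smul]
        rw [Finset.sum_sub_distrib, ← Finset.smul_sum,
          (hw.mono (Finset.subset_insert a s)).sum_smul_eq]
        simp) a (Finset.mem_insert_self a s)
    have h0 := hw'.nonneg a
    rw [heq, hw.eq_zero a ha] at h0
    simp at h0
    linarith
  obtain ⟨w, x, hw, hpos⟩ := exists_isBarycentric_pos (K.nonempty_of_mem_faces hsK)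
  refine ⟨hsK, fun p hp => ?_⟩
  obtain ⟨w', hw'⟩ := mem_convexHull_iff_exists_isBarycentric.1 hp
  have hbar : ∀ r ∈ Icc (0 : ℝ) 1, IsBarycentric s (fun y => (1 - r) * w' y + r * w y)
      ((1 - r) • p + r • x) := fun r hr =>
    hw'.combo hw (by linarith [hr.2]) hr.1 (by ring)
  have hmaps : MapsTo (fun r : ℝ => (1 - r) • p + r • x) (Icc 0 1) K.space := fun r hr =>
    K.convexHull_subset_space hsK (hbar r hr).mem_convexHull
  have hcont : ContinuousOn (fun r : ℝ => ‖φ ((1 - r) • p + r • x)‖) (Icc 0 1) :=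
    (hφ.comp (by fun_prop) hmaps).norm
  have hlim : Tendsto (fun r : ℝ => ‖φ ((1 - r) • p + r • x)‖) (𝓝[>] 0) (𝓝 ‖φ p‖) := by
    have := (hcont 0 (by simp)).tendsto.mono_left
      (nhdsWithin_mono (0 : ℝ) (Ioc_subset_Icc_self (a := (0 : ℝ)) (b := 1)))
    rw [nhdsWithin_Ioc_eq_nhdsGT one_pos] at this
    simpa using this
  have hp1 : ‖φ p‖ = 1 := by
    refine tendsto_nhds_unique hlim (tendsto_const_nhds.congr' ?_)
    filter_upwards [Ioc_mem_nhdsGT (one_pos (α := ℝ))] with r hr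
    refine (hint _ _ (hbar r (Ioc_subset_Icc_self hr)) fun y hy => ?_).symm
    exact add_pos_of_nonneg_of_pos (mul_nonneg (by linarith [hr.2]) (hw'.nonneg y))
      (mul_pos hr.1 (hpos y hy))
  have hpK : p ∈ K.space := K.convexHull_subset_space hsK hp
  exact ⟨h, ⟨φ p, hφm hpK⟩, hp1, by rw [hh, hψφ hpK]⟩

/-- In a triangulated ball of dimension `i + 1`, a simplex of dimension `i` is contained in an odd
number of `(i + 1)`-simplices if and only if it lies in the boundary. -/
theorem IsBallTriangulation.odd_ncard_cofaces_iff (hK : IsBallTriangulation (i + 1) K)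
    {s : Finset (EuclideanSpace ℝ (Fin d))} (hs : s.card = i + 1) (hsK : s ∈ K.faces) :
    Odd {t | t ∈ K.faces ∧ t.card = i + 2 ∧ s ⊆ t}.ncard ↔ s ∈ boundaryFaces (i + 1) K := by
  classical
  set A := {t | t ∈ K.faces ∧ t.card = i + 2 ∧ s ⊆ t} with hA
  have hAfin : A.Finite := hK.1.subset fun t ht => ht.1
  have hAi : ∀ t ∈ A, ∃ a ∉ s, insert a s = t := by
    rintro t ⟨-, htc, hst⟩
    exact Finset.exists_eq_insert_iff.2 ⟨hst, by omega⟩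
  obtain ⟨t, ht, hst⟩ := hK.exists_ssuperset hs hsK
  have htA : t ∈ A := by
    have := hK.card_le ht
    have := Finset.card_lt_card hst
    exact ⟨ht, by omega, hst.1⟩
  obtain ⟨a, ha, rfl⟩ := hAi t htA
  by_cases h1 : ∃ b, b ∉ s ∧ a ≠ b ∧ insert b s ∈ K.faces
  · obtain ⟨b, hb, hab, hsb⟩ := h1
    have hA2 : A = {insert a s, insert b s} := by
      ext r
      constructor
      · intro hr
        obtain ⟨c, hc, rfl⟩ := hAi r hr
        by_contra hne
        simp only [mem_insert_iff, mem_singleton_iff, not_or] at hne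
        exact hK.not_three_simplices hs hsK ha hb hc hab (fun h => hne.1 (by rw [h]))
          (fun h => hne.2 (by rw [h])) ht hsb hr.1
      · rintro (rfl | rfl)
        · exact htA
        · exact ⟨hsb, by rw [Finset.card_insert_of_notMem hb, hs], Finset.subset_insert _ _⟩
    have hne : insert a s ≠ insert b s := fun h => by
      have : a ∈ insert b s := h ▸ Finset.mem_insert_self a s
      simp [hab, ha] at this
    rw [hA2, ncard_pair hne]
    refine iff_of_false (by decide) (notMem_boundaryFaces_of_two_simplices hs ha hb hab ht hsb)
  · have hA1 : A = {insert a s} := by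
      refine Subset.antisymm (fun r hr => ?_) (singleton_subset_iff.2 htA)
      obtain ⟨c, hc, rfl⟩ := hAi r hr
      by_contra hne
      exact h1 ⟨c, hc, fun h => hne (by rw [h]; rfl), hr.1⟩
    rw [hA1, ncard_singleton]
    refine iff_of_true odd_one (hK.mem_boundaryFaces hs hsK ha ht fun r hr hsr => ?_)
    by_cases hrs : r = s
    · rw [hrs]; exact Finset.subset_insert _ _
    · have hrA : r ∈ A := by
        have := hK.card_le hr
        have := Finset.card_lt_card (hsr.ssubset_of_ne (Ne.symm hrs))
        exact ⟨hr, by omega, hsr⟩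
      rw [hA1] at hrA
      rw [mem_singleton_iff.1 hrA]

end BallTriangulation
/-! ### Labellings and their faces -/

section Labellings

variable {L : Type*}

open Classical in
-- Counting sub-multisets with multiplicity is counting faces of a simplex with distinct vertices.
-- With `exists_simplexLabelling_eq`, statements on labellings become counts of subsets.
theorem faceDegree_simplexLabelling {V : Type*} (i : ℕ) (P : Set (Multiset L)) (f : V → L)
    (s : Finset V) : faceDegree i P (simplexLabelling f s) =
      ((s.powersetCard (i + 1)).filter fun t => simplexLabelling f t ∈ P).card := by
  rw [faceDegree, simplexLabelling, Multiset.powersetCard_map, ← Finset.map_val_val_powersetCard,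
    Multiset.map_map, Multiset.countP_map]
  rfl

theorem exists_simplexLabelling_eq (l : Multiset L) :
    ∃ f : Fin l.card → L, simplexLabelling f Finset.univ = l := by
  refine ⟨fun k => l.toList.get (k.cast (by simp)), ?_⟩
  have h : (List.finRange l.card).map (fun k => l.toList.get (k.cast (by simp))) = l.toList := by
    apply List.ext_get <;> simp
  rw [simplexLabelling, show (Finset.univ : Finset (Fin l.card)).val = ↑(List.finRange l.card) from rfl,
    Multiset.map_coe, h, Multiset.coe_toList]

open Classical in
/-- The number of intermediate sets of codimension one. -/
theorem card_filter_powersetCard_superset {V : Type*} {s u : Finset V} {k : ℕ} (hu : u.card = k)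
    (hus : u ⊆ s) : ((s.powersetCard (k + 1)).filter fun t => u ⊆ t).card = s.card - k := by
  rw [← hu, ← Finset.card_sdiff_of_subset hus,
    ← Finset.card_image_of_injOn (f := fun a => insert a u) (s := s \ u)]
  · congr 1
    ext t
    simp only [Finset.mem_filter, Finset.mem_powersetCard, Finset.mem_image, Finset.mem_sdiff]
    constructor
    · rintro ⟨⟨hts, htc⟩, hut⟩
      obtain ⟨a, ha, rfl⟩ := Finset.exists_eq_insert_iff.2 ⟨hut, htc.symm⟩
      exact ⟨a, ⟨hts (Finset.mem_insert_self a u), ha⟩, rfl⟩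
    · rintro ⟨a, ⟨has, hau⟩, rfl⟩
      exact ⟨⟨Finset.insert_subset has hus, Finset.card_insert_of_notMem hau⟩,
        Finset.subset_insert a u⟩
  · intro a ha b hb hab
    have ha' : a ∉ u := (Finset.mem_sdiff.1 ha).2
    have hab' : insert a u = insert b u := hab
    have : a ∈ insert b u := hab' ▸ Finset.mem_insert_self a u
    exact (Finset.mem_insert.1 this).resolve_right ha'

/-- Every codimension two face is contained in two facets. -/
theorem even_sum_faceDegree {V : Type*} (i : ℕ) (P : Set (Multiset L)) (f : V → L) (s : Finset V)
    (hs : s.card = i + 3) :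
    Even (∑ t ∈ s.powersetCard (i + 2), faceDegree i P (simplexLabelling f t)) := by
  classical
  have h := Finset.sum_card_bipartiteAbove_eq_sum_card_bipartiteBelow
    (s := s.powersetCard (i + 2))
    (t := (s.powersetCard (i + 1)).filter fun u => simplexLabelling f u ∈ P)
    (r := fun t u => u ⊆ t)
  have h1 : ∀ t ∈ s.powersetCard (i + 2), faceDegree i P (simplexLabelling f t) =
      (Finset.bipartiteAbove (fun t u => u ⊆ t)
        ((s.powersetCard (i + 1)).filter fun u => simplexLabelling f u ∈ P) t).card := by
    intro t ht
    rw [faceDegree_simplexLabelling]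
    congr 1
    ext u
    simp only [Finset.bipartiteAbove, Finset.mem_filter, Finset.mem_powersetCard]
    have hts := (Finset.mem_powersetCard.1 ht).1
    exact ⟨fun h => ⟨⟨⟨h.1.1.trans hts, h.1.2⟩, h.2⟩, h.1.1⟩,
      fun h => ⟨⟨h.2, h.1.1.2⟩, h.1.2⟩⟩
  rw [Finset.sum_congr rfl h1, h]
  refine Finset.even_sum _ fun u hu => ?_
  obtain ⟨hus, huc⟩ := Finset.mem_powersetCard.1 (Finset.mem_filter.1 hu).1
  rw [Finset.bipartiteBelow, card_filter_powersetCard_superset huc hus, hs]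
  exact ⟨1, by omega⟩

variable {F : Set (Multiset L)} {Mplus : ℕ → Set (Multiset L)}

/-- A labelling all of whose faces are admissible contains an even number of facets in `Mⁱ`. -/
theorem even_faceDegree_oddLabellings {i : ℕ} {l : Multiset L} (hl : l.card = i + 2)
    (hF : ∀ l' ≤ l, l'.card = i + 1 → l' ∉ F) :
    Even (faceDegree i (oddLabellings F Mplus i) l) := by
  classical
  cases i with
  | zero =>
    -- Both labels count, since `M⁰` consists of all `0`-labellings.
    have h : faceDegree 0 (oddLabellings F Mplus 0) l = 2 := by
      have hall : ∀ l' ∈ Multiset.powersetCard (0 + 1) l, l' ∈ oddLabellings F Mplus 0 :=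
        fun l' hl' => (Multiset.mem_powersetCard.1 hl').2
      rw [faceDegree, Multiset.countP_eq_card.2 hall]
      simp [Multiset.card_powersetCard, hl]
    rw [h]
    exact even_two
  | succ i =>
    obtain ⟨f, hf⟩ := exists_simplexLabelling_eq l
    have hcard : (Finset.univ : Finset (Fin l.card)).card = i + 3 := by simpa using hl
    rw [← hf, faceDegree_simplexLabelling]
    have h := even_sum_faceDegree i (Mplus i) f _ hcard
    rw [← Nat.not_odd_iff_even, Finset.odd_sum_iff_odd_card_odd, Nat.not_odd_iff_even] at h
    rw [Finset.filter_congr (q := fun t => Odd (faceDegree i (Mplus i) (simplexLabelling f t)))]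
    · exact h
    · intro t ht
      have htc : (simplexLabelling f t).card = i + 2 := by
        simpa [simplexLabelling] using (Finset.mem_powersetCard.1 ht).2
      refine ⟨fun h => h.2, fun h => ⟨⟨htc, hF _ ?_ htc⟩, h⟩⟩
      exact (Multiset.map_le_map (Finset.val_le_iff.2 (Finset.subset_univ t))).trans hf.le

variable [InvolutiveNeg L]

theorem oppositeLabelling_oppositeLabelling (l : Multiset L) :
    oppositeLabelling (oppositeLabelling l) = l := by
  simp [oppositeLabelling]

theorem faceDegree_oppositeLabelling (i : ℕ) (P : Set (Multiset L)) (l : Multiset L) :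
    faceDegree i P (oppositeLabelling l) = faceDegree i (oppositeLabelling ⁻¹' P) l := by
  classical
  rw [faceDegree, oppositeLabelling, Multiset.powersetCard_map, Multiset.countP_map, faceDegree,
    Multiset.countP_eq_card_filter]
  rfl

/-- A well-order on labellings selects the smaller one of each opposite pair. -/
theorem StrictlySymmetric.exists_isPlusPart {M : Set (Multiset L)} (hM : StrictlySymmetric M) :
    ∃ P, IsPlusPart P M := by
  refine ⟨{l | l ∈ M ∧ WellOrderingRel l (oppositeLabelling l)}, fun l hl => hl.1, fun l hl => ?_⟩
  obtain ⟨ho, hne⟩ := hM l hl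
  simp only [Set.mem_ofPred_eq, hl, ho, true_and, oppositeLabelling_oppositeLabelling]
  rcases trichotomous_of WellOrderingRel l (oppositeLabelling l) with h | h | h
  · exact Or.inl ⟨h, asymm_of WellOrderingRel h⟩
  · exact absurd h.symm hne
  · exact Or.inr ⟨asymm_of WellOrderingRel h, h⟩

/-- A labelling lies in `M` if and only if exactly one of it and its opposite lies in the `+` part. -/
theorem IsPlusPart.mem_iff {P M : Set (Multiset L)} (hP : IsPlusPart P M)
    (hM : StrictlySymmetric M) (l : Multiset L) :
    (l ∈ M ↔ l ∈ P ∨ oppositeLabelling l ∈ P) ∧ ¬ (l ∈ P ∧ oppositeLabelling l ∈ P) := by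
  refine ⟨⟨fun h => ?_, ?_⟩, fun h => ?_⟩
  · rcases hP.2 l h with h | h
    exacts [Or.inl h.1, Or.inr h.2]
  · rintro (h | h)
    · exact hP.1 h
    · rw [← oppositeLabelling_oppositeLabelling l]
      exact (hM _ (hP.1 h)).1
  · rcases hP.2 l (hP.1 h.1) with h' | h'
    exacts [h'.2 h.2, h'.1 h.1]

open Classical in
theorem IsPlusPart.faceDegree_eq {P M : Set (Multiset L)} (hP : IsPlusPart P M)
    (hM : StrictlySymmetric M) (i : ℕ) (l : Multiset L) :
    faceDegree i M l = faceDegree i P l + faceDegree i P (oppositeLabelling l) := by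
  rw [faceDegree_oppositeLabelling]
  simp only [faceDegree]
  induction Multiset.powersetCard (i + 1) l using Multiset.induction_on with
  | empty => simp
  | cons a m ih =>
    have := hP.mem_iff hM a
    simp only [Multiset.countP_cons, ih, Set.mem_preimage]
    by_cases h1 : a ∈ P <;> by_cases h2 : oppositeLabelling a ∈ P <;> simp_all <;> omega

theorem strictlySymmetric_oddLabellings_zero (hL : ∀ a : L, -a ≠ a) :
    StrictlySymmetric (oddLabellings F Mplus 0) := by
  intro l hl
  obtain ⟨a, rfl⟩ := Multiset.card_eq_one.1 (show l.card = 1 from hl)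
  exact ⟨by simp [oppositeLabelling, oddLabellings, labellings], by simpa [oppositeLabelling] using hL a⟩

/-- The `+` counts of `l` and of its opposite add up to the number of faces of `l` in `Mⁱ`, which is
even; so one is odd exactly when the other is. -/
theorem strictlySymmetric_oddLabellings_succ {i : ℕ}
    (hF : StrictlySymmetric (labellings L (i + 1) \ F))
    (hFup : ∀ l ∈ F, ∀ l' ∈ labellings L (i + 1), l ≤ l' → l' ∈ F)
    (hM : StrictlySymmetric (oddLabellings F Mplus i))
    (hP : IsPlusPart (Mplus i) (oddLabellings F Mplus i)) :
    StrictlySymmetric (oddLabellings F Mplus (i + 1)) := by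
  rintro l ⟨hl, hodd⟩
  refine ⟨⟨(hF l hl).1, ?_⟩, (hF l hl).2⟩
  have h := even_faceDegree_oddLabellings (F := F) (Mplus := Mplus) hl.1
    fun l' hl' _ h => hl.2 (hFup l' h l hl.1 hl')
  rw [hP.faceDegree_eq hM, Nat.even_add'] at h
  exact h.1 hodd

end Labellings
/-! ### Counting simplices -/

section Parity

variable {d : ℕ} {n : ℕ} {T : Geometry.SimplicialComplex ℝ (EuclideanSpace ℝ (Fin d))}
  {Ts : ℕ → Geometry.SimplicialComplex ℝ (EuclideanSpace ℝ (Fin d))}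

theorem IsHemisphereSequence.faces_subset (hTs : IsHemisphereSequence n T Ts) {i : ℕ} (hi : i ≤ n) :
    (Ts i).faces ⊆ T.faces := by
  induction hi using Nat.decreasingInduction with
  | self => rw [hTs.top_eq]
  | of_succ k hk ih =>
    intro s hs
    have : s ∈ boundaryFaces (k + 1) (Ts (k + 1)) := hTs.union_eq k hk ▸ Or.inl hs
    exact ih this.1

/-- The antisymmetry of `lam` is assumed only on the boundary of `T`; this makes it available on
every lower hemisphere. -/
theorem IsHemisphereSequence.faces_subset_boundaryFaces (hTs : IsHemisphereSequence n T Ts) {i : ℕ}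
    (hi : i < n) : (Ts i).faces ⊆ boundaryFaces n T := by
  obtain ⟨m, rfl⟩ := Nat.exists_eq_add_of_lt hi
  rw [← hTs.top_eq, ← hTs.union_eq (i + m) (by omega)]
  refine Set.Subset.trans ?_ Set.subset_union_left
  have : ∀ k ≤ m, (Ts i).faces ⊆ (Ts (i + k)).faces := by
    intro k hk
    induction k with
    | zero => exact subset_rfl
    | succ k ih =>
      intro s hs
      have : s ∈ boundaryFaces (i + k + 1) (Ts (i + k + 1)) :=
        hTs.union_eq (i + k) (by omega) ▸ Or.inl (ih (by omega) hs)
      exact this.1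
  exact this m le_rfl

variable {L : Type*} {lam : EuclideanSpace ℝ (Fin d) → L}

/-- Modulo two, the number of `(i + 1)`-simplices with an odd number of facets labelled in `P` is
the number of boundary simplices labelled in `P`. -/
theorem IsBallTriangulation.odd_ncard_iff {i : ℕ}
    {K : Geometry.SimplicialComplex ℝ (EuclideanSpace ℝ (Fin d))}
    (hK : IsBallTriangulation (i + 1) K) (P : Set (Multiset L)) :
    Odd {t | t ∈ K.faces ∧ t.card = i + 2 ∧ Odd (faceDegree i P (simplexLabelling lam t))}.ncard ↔
      Odd {s | s ∈ boundaryFaces (i + 1) K ∧ s.card = i + 1 ∧ simplexLabelling lam s ∈ P}.ncard := by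
  classical
  set A := hK.1.toFinset with hA
  have hmem : ∀ t, t ∈ A ↔ t ∈ K.faces := fun t => by simp [hA]
  set B := A.filter fun t => t.card = i + 2 with hB
  set C := A.filter fun s => s.card = i + 1 ∧ simplexLabelling lam s ∈ P with hC
  have e1 : {t | t ∈ K.faces ∧ t.card = i + 2 ∧ Odd (faceDegree i P (simplexLabelling lam t))} =
      ↑(B.filter fun t => Odd (faceDegree i P (simplexLabelling lam t))) := by
    ext t; simp [hB, hmem, and_assoc]
  have e2 : {s | s ∈ boundaryFaces (i + 1) K ∧ s.card = i + 1 ∧ simplexLabelling lam s ∈ P} =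
      ↑(C.filter fun s => Odd (B.filter fun t => s ⊆ t).card) := by
    ext s
    simp only [Set.mem_ofPred_eq, Finset.coe_filter, hC, Finset.mem_filter, hmem]
    constructor
    · rintro ⟨hs, hsc, hsP⟩
      refine ⟨⟨hs.1, hsc, hsP⟩, ?_⟩
      have := (hK.odd_ncard_cofaces_iff hsc hs.1).2 hs
      rw [← Set.ncard_coe_finset]
      convert! this using 2
      ext t; simp [hB, hmem, and_assoc]
    · rintro ⟨⟨hs, hsc, hsP⟩, hodd⟩
      refine ⟨(hK.odd_ncard_cofaces_iff hsc hs).1 ?_, hsc, hsP⟩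
      rw [← Set.ncard_coe_finset] at hodd
      convert! hodd using 2
      ext t; simp [hB, hmem, and_assoc]
  -- Modulo two, each side is a sum of incidence numbers, and the two sums agree by double counting.
  rw [e1, e2, Set.ncard_coe_finset, Set.ncard_coe_finset, ← Finset.odd_sum_iff_odd_card_odd,
    ← Finset.odd_sum_iff_odd_card_odd]
  have h := Finset.sum_card_bipartiteAbove_eq_sum_card_bipartiteBelow (s := B) (t := C)
    (r := fun t s => s ⊆ t)
  have h1 : ∀ t ∈ B, faceDegree i P (simplexLabelling lam t) =
      (Finset.bipartiteAbove (fun t s => s ⊆ t) C t).card := by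
    intro t ht
    rw [faceDegree_simplexLabelling]
    congr 1
    ext s
    simp only [Finset.bipartiteAbove, Finset.mem_filter, Finset.mem_powersetCard, hC, hmem]
    have htK := (hmem t).1 (Finset.mem_filter.1 ht).1
    exact ⟨fun h => ⟨⟨K.down_closed htK h.1.1 (Finset.card_pos.1 (by omega)), h.1.2, h.2⟩, h.1.1⟩,
      fun h => ⟨⟨h.2, h.1.2.1⟩, h.1.2.2⟩⟩
  rw [Finset.sum_congr rfl h1, h]
  rfl

variable [InvolutiveNeg L]

/-- The reflection of a simplex. -/
noncomputable abbrev negFace (s : Finset (EuclideanSpace ℝ (Fin d))) :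
    Finset (EuclideanSpace ℝ (Fin d)) :=
  s.map (Equiv.neg (EuclideanSpace ℝ (Fin d))).toEmbedding

theorem simplexLabelling_negFace
    (hlam : ∀ v ∈ T.vertices, v ∈ ballBoundary n T.space → lam v = -lam (-v))
    {s : Finset (EuclideanSpace ℝ (Fin d))} (hs : s ∈ boundaryFaces n T) :
    simplexLabelling lam (negFace s) = oppositeLabelling (simplexLabelling lam s) := by
  rw [simplexLabelling, simplexLabelling, oppositeLabelling, Finset.map_val, Multiset.map_map,
    Multiset.map_map]
  refine Multiset.map_congr rfl fun v hv => ?_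
  have h := hlam v (T.down_closed hs.1 (Finset.singleton_subset_iff.2 hv) (by simp))
    (hs.2 (subset_convexHull ℝ _ hv))
  simp [h]

theorem ncard_zero_dimensional {K : Geometry.SimplicialComplex ℝ (EuclideanSpace ℝ (Fin d))}
    (hK : IsBallTriangulation 0 K) : {s | s ∈ K.faces ∧ s.card = 1}.ncard = 1 := by
  obtain ⟨-, ⟨h⟩⟩ := hK
  obtain ⟨t, ht, -⟩ := K.mem_space_iff.1 (h ⟨0, by simp⟩).2
  obtain ⟨v, hv⟩ := K.nonempty_of_mem_faces ht
  have hvK : {v} ∈ K.faces := K.down_closed ht (Finset.singleton_subset_iff.2 hv) (by simp)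
  rw [Set.ncard_eq_one]
  refine ⟨{v}, Set.Subset.antisymm ?_ (Set.singleton_subset_iff.2 ⟨hvK, by simp⟩)⟩
  rintro s ⟨hs, hsc⟩
  obtain ⟨v', rfl⟩ := Finset.card_eq_one.1 hsc
  have hX : ∀ v, {v} ∈ K.faces → v ∈ K.space := fun v hv => K.subset_space hv (by simp)
  have hsub : h.symm ⟨v', hX v' hs⟩ = h.symm ⟨v, hX v hvK⟩ := Subtype.ext (Subsingleton.elim _ _)
  have := congrArg Subtype.val (h.symm.injective hsub)
  simpa using this

/-- A simplex of `Tⁱ` labelled in `M` either is labelled in `P` itself or has a reflection labelled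
in `P`, never both. The hemisphere `Tⁱ` and its reflection share only simplices of `∂Tⁱ`, none of
which has dimension `i`, so nothing is counted twice. -/
theorem IsHemisphereSequence.ncard_boundary_eq (hTs : IsHemisphereSequence n T Ts)
    (hlam : ∀ v ∈ T.vertices, v ∈ ballBoundary n T.space → lam v = -lam (-v)) {i : ℕ} (hi : i < n)
    {P M : Set (Multiset L)} (hP : IsPlusPart P M) (hM : StrictlySymmetric M) :
    {s | s ∈ boundaryFaces (i + 1) (Ts (i + 1)) ∧ s.card = i + 1 ∧
      simplexLabelling lam s ∈ P}.ncard =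
    {s | s ∈ (Ts i).faces ∧ s.card = i + 1 ∧ simplexLabelling lam s ∈ M}.ncard := by
  have hfin := (hTs.ball i hi.le).1
  set D₁ := {s | s ∈ (Ts i).faces ∧ s.card = i + 1 ∧ simplexLabelling lam s ∈ P} with hD₁
  set D₂ := {s | s ∈ (Ts i).faces ∧ s.card = i + 1 ∧
    oppositeLabelling (simplexLabelling lam s) ∈ P} with hD₂
  have hf₁ : D₁.Finite := hfin.subset fun s hs => hs.1
  have hf₂ : D₂.Finite := hfin.subset fun s hs => hs.1
  have hlab : ∀ s ∈ (Ts i).faces, simplexLabelling lam (negFace s) =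
      oppositeLabelling (simplexLabelling lam s) := fun s hs =>
    simplexLabelling_negFace hlam (hTs.faces_subset_boundaryFaces hi hs)
  have e1 : {s | s ∈ boundaryFaces (i + 1) (Ts (i + 1)) ∧ s.card = i + 1 ∧
      simplexLabelling lam s ∈ P} = D₁ ∪ negFace '' D₂ := by
    rw [← hTs.union_eq i hi]
    ext s
    constructor
    · rintro ⟨hs | ⟨t, ht, rfl⟩, hsc, hsP⟩
      · exact Or.inl ⟨hs, hsc, hsP⟩
      · exact Or.inr ⟨t, ⟨ht, by simpa using hsc, hlab t ht ▸ hsP⟩, rfl⟩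
    · rintro (hs | ⟨t, ⟨ht, htc, htP⟩, rfl⟩)
      · exact ⟨Or.inl hs.1, hs.2⟩
      · exact ⟨Or.inr ⟨t, ht, rfl⟩, by simpa using htc, (hlab t ht).symm ▸ htP⟩
  have e2 : {s | s ∈ (Ts i).faces ∧ s.card = i + 1 ∧ simplexLabelling lam s ∈ M} = D₁ ∪ D₂ := by
    ext s
    simp only [hD₁, hD₂, Set.mem_ofPred_eq, Set.mem_union, (hP.mem_iff hM _).1]
    tauto
  have hd1 : Disjoint D₁ (negFace '' D₂) := by
    rw [Set.disjoint_left]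
    rintro _ hs ⟨t, ht, rfl⟩
    have : negFace t ∈ boundaryFaces i (Ts i) := hTs.inter_eq i hi ▸ ⟨hs.1, t, ht.1, rfl⟩
    exact notMem_boundaryFaces_of_card_eq hs.2.1 this
  have hd2 : Disjoint D₁ D₂ := by
    rw [Set.disjoint_left]
    exact fun s hs hs' => (hP.mem_iff hM _).2 ⟨hs.2.2, hs'.2.2⟩
  rw [e1, e2, Set.ncard_union_eq hd1 hf₁ (hf₂.image _), Set.ncard_union_eq hd2 hf₁ hf₂,
    Set.ncard_image_of_injective _ (Finset.map_injective _)]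

end Parity

/-! ### The parity induction -/

theorem mainTheorem3 {n d : ℕ}
    (T : Geometry.SimplicialComplex ℝ (EuclideanSpace ℝ (Fin d)))
    (hTball : IsBallTriangulation n T)
    (hTsymm : AntipodallySymmetricOnBoundary n T)
    (Ts : ℕ → Geometry.SimplicialComplex ℝ (EuclideanSpace ℝ (Fin d)))
    (hTs : IsHemisphereSequence n T Ts)
    {L : Type*} [InvolutiveNeg L] (hL : ∀ a : L, -a ≠ a)
    (F : Set (Multiset L))
    (hF : ∀ l ∈ F, ∃ i ≤ n, l ∈ labellings L i)
    (hFsymm : ∀ i ≤ n, StrictlySymmetric (labellings L i \ F))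
    (hFup : ∀ l ∈ F, ∀ i ≤ n, ∀ l' ∈ labellings L i, l ≤ l' → l' ∈ F)
    (lam : EuclideanSpace ℝ (Fin d) → L)
    (hlam : ∀ v ∈ T.vertices, v ∈ ballBoundary n T.space → lam v = -lam (-v))
    (hfree : ∀ s ∈ T.faces, simplexLabelling lam s ∉ F)
    (Mplus : ℕ → Set (Multiset L)) :
    ∀ i ≤ n, (∀ j < i, IsPlusPart (Mplus j) (oddLabellings F Mplus j)) →
      StrictlySymmetric (oddLabellings F Mplus i) ∧
      (∃ P : Set (Multiset L), IsPlusPart P (oddLabellings F Mplus i)) ∧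
      Odd {s : Finset (EuclideanSpace ℝ (Fin d)) | s ∈ (Ts i).faces ∧ s.card = i + 1 ∧
        simplexLabelling lam s ∈ oddLabellings F Mplus i}.ncard := by
  have hsymm : ∀ i ≤ n, (∀ j < i, IsPlusPart (Mplus j) (oddLabellings F Mplus j)) →
      StrictlySymmetric (oddLabellings F Mplus i) := by
    intro i
    induction i with
    | zero => exact fun _ _ => strictlySymmetric_oddLabellings_zero hL
    | succ i ih =>
      exact fun hi hM => strictlySymmetric_oddLabellings_succ (hFsymm _ hi)
        (fun l hl l' hl' hle => hFup l hl _ hi l' hl' hle)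
        (ih (by omega) fun j hj => hM j (by omega)) (hM i (by omega))
  intro i hi hM
  refine ⟨hsymm i hi hM, (hsymm i hi hM).exists_isPlusPart, ?_⟩
  induction i with
  | zero =>
    have h := ncard_zero_dimensional (hTs.ball 0 hi)
    convert! odd_one
    convert! h using 5 with s
    refine and_iff_left_of_imp fun hs => ?_
    simpa [oddLabellings, labellings, simplexLabelling] using hs
  | succ i ih =>
    have hM' : ∀ j < i, IsPlusPart (Mplus j) (oddLabellings F Mplus j) := fun j hj =>
      hM j (by omega)
    have h := ih (by omega) hM'
    rw [← hTs.ncard_boundary_eq hlam (by omega : i < n) (hM i (by omega))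
      (hsymm i (by omega) hM'), ← (hTs.ball (i + 1) hi).odd_ncard_iff] at h
    -- No simplex of `T` has a forbidden labelling, so membership in `Mⁱ⁺¹` reduces to the oddness
    -- condition.
    have e : {s | s ∈ (Ts (i + 1)).faces ∧ s.card = i + 1 + 1 ∧
        simplexLabelling lam s ∈ oddLabellings F Mplus (i + 1)} =
        {s | s ∈ (Ts (i + 1)).faces ∧ s.card = i + 2 ∧
          Odd (faceDegree i (Mplus i) (simplexLabelling lam s))} := by
      ext s
      refine and_congr_right fun hs => and_congr_right fun hsc =>
        ⟨fun h => h.2, fun h => ⟨⟨?_, hfree s (hTs.faces_subset hi hs)⟩, h⟩⟩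
      simpa [labellings, simplexLabelling] using hsc
    rw [e]
    exact h
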